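/- **Setting.** Let $L>0$ and $\Phi_S\in C^1(\mathbb{R}^3)$ with $\nabla\Phi_S(s)\neq 0$ for every $s\in S=\{\Phi_S=0\}$; put $n_S=\nabla\Phi_S/|\nabla\Phi_S|$, with the convention $n_S(s)=0$ where $\nabla\Phi_S(s)=0$. Let $L_{\rm bc}:H^2(0,L;\mathbb{R}^3)\to\mathbb{R}^\ell$ be bounded and linear, such that $L_{\rm bc}[v]$ depends only on $v(0),v(L),v'(0),v'(L)$, and let $\ell_{\rm bc}\in\mathbb{R}^\ell$. Define $$\mathcal{A}=\{v\in H^2(0,L;\mathbb{R}^3):\ |v'|^2=1,\ \Phi_S(v)=0 \text{ in } (0,L),\ L_{\rm bc}[v]=\ell_{\rm bc}\}.$$ For a partition $0=z_0<z_1<\dots<z_J=L$ with maximal mesh size $h=\max_{j}|z_j-z_{j-1}|$ let $V_h$ be the space of curves $v_h\in C^1([0,L];\mathbb{R}^3)$ whose restriction to each $[z_{j-1},z_j]$ is a polynomial of degree at most $3$, and let $$\mathcal{A}_h=\{v_h\in V_h:\ |v_h'(z_j)|^2=1,\ \Phi_S(v_h(z_j))=0 \ (j=0,\dots,J),\ L_{\rm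 bc}[v_h]=\ell_{\rm bc}\}.$$ For $0\le\gamma<1$ define on $H^2(0,L;\mathbb{R}^3)$ the functional $$I_\gamma[u]=\frac12\int_0^L |u''|^2-\gamma\,|u''\cdot n_S(u)|^2\,dx \ \text{ if } u\in\mathcal{A},\qquad I_\gamma[u]=+\infty \ \text{ otherwise},$$ and define $I_{\gamma,h}$ by the same formula with $\mathcal{A}$ replaced by $\mathcal{A}_h$. Assume that $\mathcal{A}\neq\emptyset$, that the seminorm $v\mapsto\|v''\|_{L^2(0,L)}$ is a norm on the kernel of $L_{\rm bc}$, and that $\mathcal{A}\cap H^3(0,L;\mathbb{R}^3)$ is dense in $\mathcal{A}$ with respect to strong convergence in $H^2$. **Proposition ($\Gamma$-convergence).** For every sequence of partitions with maximal mesh sizes $h\to0$, the functionals $I_{\gamma,h}$ $\Gamma$-converge to $I_\gamma$ with respect to weak convergence in $H^2(0,L;\mathbb{R}^3)$. More precisely: (i) If $u_h\in\mathcal{A}_h$ and $I_{\gamma,h}[u_h]\le c$ for all $h$, with $c$ independent of $h$, then there is $u\in\mathcal{A}$ such that $u_h\rightharpoonup u$ in $H^2$ along a subsequence and $I_\gamma[u]\le\liminf_{h\to0}I_{\gamma,h}[u_h]$.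 Moreover, $I_\gamma[u]\le\liminf_{h\to0}I_{\gamma,h}[u_h]$ for all $u_h,u\in H^2(0,L;\mathbb{R}^3)$ with $u_h\rightharpoonup u$ in $H^2$. (ii) For every $u\in\mathcal{A}$ there is a sequence $(u_h)\subset H^2(0,L;\mathbb{R}^3)$ with $u_h\to u$ strongly in $H^2$ and $I_\gamma[u]=\lim_{h\to0}I_{\gamma,h}[u_h]$. (iii) Let $(u_h)$ be a sequence of quasiminimizers, i.e. $I_{\gamma,h}[u_h]\le I_{\gamma,h}[v]+\varepsilon_h$ for all $v\in H^2(0,L;\mathbb{R}^3)$, with $\varepsilon_h\ge0$ and $\varepsilon_h\to0$. If a subsequence of $(u_h)$ converges weakly in $H^2$ to $u$, then $u\in\mathcal{A}$ and $u$ minimizes $I_\gamma$ over $H^2(0,L;\mathbb{R}^3)$. -/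

import Mathlib

open MeasureTheory Set Filter Topology
open scoped ContDiff Polynomial

noncomputable section

namespace CurveFEM

/-- Euclidean three-space. -/
abbrev E3 : Type := EuclideanSpace ℝ (Fin 3)

/-- The Lebesgue space `L²(0,L;ℝ³)`. -/
abbrev L2 (L : ℝ) : Type := Lp E3 2 (volume.restrict (Ioo (0 : ℝ) L))

/-- Test functions: smooth real functions with compact support in `(0,L)`. -/
def IsTest (L : ℝ) (φ : ℝ → ℝ) : Prop :=
  ContDiff ℝ ∞ φ ∧ HasCompactSupport φ ∧ tsupport φ ⊆ Ioo (0 : ℝ) L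

/-- `g` is the weak derivative of `f` on `(0,L)`. -/
def IsWeakDeriv {L : ℝ} (f g : L2 L) : Prop :=
  ∀ φ : ℝ → ℝ, IsTest L φ →
    ∫ x in Ioo (0 : ℝ) L, deriv φ x • f x = - ∫ x in Ioo (0 : ℝ) L, φ x • g x

theorem integrable_smul_L2 {L : ℝ} (f : L2 L) {φ : ℝ → ℝ} (hc : Continuous φ)
    (hs : HasCompactSupport φ) :
    Integrable (fun x => φ x • f x) (volume.restrict (Ioo (0 : ℝ) L)) := by
  obtain ⟨C, hC⟩ := hs.exists_bound_of_continuous hc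
  have hf : Integrable f (volume.restrict (Ioo (0 : ℝ) L)) :=
    (Lp.memLp f).integrable one_le_two
  exact hf.bdd_smul C hc.aestronglyMeasurable (Eventually.of_forall hC)

theorem integral_smul_add_L2 {L : ℝ} (f g : L2 L) {φ : ℝ → ℝ} (hc : Continuous φ)
    (hs : HasCompactSupport φ) :
    ∫ x in Ioo (0 : ℝ) L, φ x • (f + g) x =
      (∫ x in Ioo (0 : ℝ) L, φ x • f x) + ∫ x in Ioo (0 : ℝ) L, φ x • g x := by
  rw [← integral_add (integrable_smul_L2 f hc hs) (integrable_smul_L2 g hc hs)]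
  refine integral_congr_ae ?_
  filter_upwards [Lp.coeFn_add f g] with x hx
  rw [hx, Pi.add_apply, smul_add]

theorem integral_smul_smul_L2 {L : ℝ} (c : ℝ) (f : L2 L) (φ : ℝ → ℝ) :
    ∫ x in Ioo (0 : ℝ) L, φ x • (c • f) x = c • ∫ x in Ioo (0 : ℝ) L, φ x • f x := by
  rw [← integral_smul]
  refine integral_congr_ae ?_
  filter_upwards [Lp.coeFn_smul c f] with x hx
  rw [hx, Pi.smul_apply, smul_comm]

theorem IsTest.continuous {L : ℝ} {φ : ℝ → ℝ} (h : IsTest L φ) : Continuous φ :=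
  h.1.continuous

theorem IsTest.continuous_deriv {L : ℝ} {φ : ℝ → ℝ} (h : IsTest L φ) : Continuous (deriv φ) :=
  h.1.continuous_deriv (by simp)

theorem IsWeakDeriv.add {L : ℝ} {f g f' g' : L2 L} (h : IsWeakDeriv f f')
    (k : IsWeakDeriv g g') : IsWeakDeriv (f + g) (f' + g') := by
  intro φ hφ
  rw [integral_smul_add_L2 f g hφ.continuous_deriv hφ.2.1.deriv,
    integral_smul_add_L2 f' g' hφ.continuous hφ.2.1, h φ hφ, k φ hφ, neg_add]

theorem IsWeakDeriv.smul {L : ℝ} {f f' : L2 L} (c : ℝ) (h : IsWeakDeriv f f') :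
    IsWeakDeriv (c • f) (c • f') := by
  intro φ hφ
  rw [integral_smul_smul_L2, integral_smul_smul_L2, h φ hφ, smul_neg]

theorem isWeakDeriv_zero {L : ℝ} : IsWeakDeriv (0 : L2 L) 0 := by
  have h0 : ∀ ψ : ℝ → ℝ, ∫ x in Ioo (0 : ℝ) L, ψ x • (0 : L2 L) x = 0 := by
    intro ψ
    have := integral_smul_smul_L2 0 (0 : L2 L) ψ
    simpa using this
  intro φ _
  rw [h0, h0, neg_zero]

/-- The Sobolev space `H²(0,L;ℝ³)`, as the Hilbert space of triples `(u, u', u'')` in `L²` in which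
each entry is the weak derivative of the preceding one.  Its norm is the usual one,
`‖u‖² = ‖u‖²_{L²} + ‖u'‖²_{L²} + ‖u''‖²_{L²}`. -/
def H2 (L : ℝ) : Submodule ℝ (PiLp 2 (fun _ : Fin 3 => L2 L)) where
  carrier := {u | IsWeakDeriv (u 0) (u 1) ∧ IsWeakDeriv (u 1) (u 2)}
  add_mem' := fun ha hb => ⟨ha.1.add hb.1, ha.2.add hb.2⟩
  zero_mem' := ⟨isWeakDeriv_zero, isWeakDeriv_zero⟩
  smul_mem' := fun c _ ha => ⟨ha.1.smul c, ha.2.smul c⟩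

/-- `D k u` is the `k`-th weak derivative of `u ∈ H²(0,L;ℝ³)`, for `k = 0, 1, 2`. -/
def D {L : ℝ} (k : Fin 3) (u : H2 L) : L2 L := (u : PiLp 2 (fun _ : Fin 3 => L2 L)) k

/-- The curves of class `H³(0,L;ℝ³)`. -/
def H3 (L : ℝ) : Set (H2 L) := {u | ∃ w : L2 L, IsWeakDeriv (D 2 u) w}

/-- Weak convergence of sequences in `H²(0,L;ℝ³)`. -/
def WeakTendsto {L : ℝ} (u : ℕ → H2 L) (u₀ : H2 L) : Prop :=
  ∀ F : H2 L →L[ℝ] ℝ, Tendsto (fun k => F (u k)) atTop (𝓝 (F u₀))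

/-- `f`, restricted to `[0,L]`, is the `C¹` representative of `u ∈ H²(0,L;ℝ³)`. -/
def IsC1Rep {L : ℝ} (u : H2 L) (f : ℝ → E3) : Prop :=
  ContDiffOn ℝ 1 f (Icc 0 L) ∧ D 0 u =ᵐ[volume.restrict (Ioo (0 : ℝ) L)] f

/-- The operator `B` depends only on the values of `v` and `v'` at the two end points. -/
def DependsOnBoundaryValues {L : ℝ} {l : ℕ} (B : H2 L →L[ℝ] EuclideanSpace ℝ (Fin l)) : Prop :=
  ∀ (u v : H2 L) (f g : ℝ → E3), IsC1Rep u f → IsC1Rep v g →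
    f 0 = g 0 → f L = g L →
    derivWithin f (Icc 0 L) 0 = derivWithin g (Icc 0 L) 0 →
    derivWithin f (Icc 0 L) L = derivWithin g (Icc 0 L) L →
    B u = B v

/-- The seminorm `v ↦ ‖v''‖` is definite, hence a norm, on the kernel of `B`. -/
def Definiteness {L : ℝ} {l : ℕ} (B : H2 L →L[ℝ] EuclideanSpace ℝ (Fin l)) : Prop :=
  ∀ v : H2 L, B v = 0 → ‖D 2 v‖ = 0 → v = 0

/-- The field `∇Φ / |∇Φ|`, with value `0` where `∇Φ = 0`. -/
def unitNormal (Φ : E3 → ℝ) (s : E3) : E3 := ‖gradient Φ s‖⁻¹ • gradient Φ s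

/-- The admissible curves: arclength parametrized, contained in `{Φ = 0}`, with `B u = b`. -/
def admissible {L : ℝ} (Φ : E3 → ℝ) {l : ℕ} (B : H2 L →L[ℝ] EuclideanSpace ℝ (Fin l))
    (b : EuclideanSpace ℝ (Fin l)) : Set (H2 L) :=
  {u | (∀ᵐ x ∂(volume.restrict (Ioo (0 : ℝ) L)), ‖D 1 u x‖ ^ 2 = 1) ∧
    (∀ᵐ x ∂(volume.restrict (Ioo (0 : ℝ) L)), Φ (D 0 u x) = 0) ∧ B u = b}

/-- Partitions `0 = z_0 < z_1 < ⋯ < z_J = L`. -/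
structure Partition (L : ℝ) where
  J : ℕ
  z : Fin (J + 1) → ℝ
  strictMono : StrictMono z
  z_zero : z 0 = 0
  z_last : z (Fin.last J) = L

/-- The maximal mesh size of a partition. -/
def Partition.mesh {L : ℝ} (P : Partition L) : ℝ :=
  ⨆ j : Fin P.J, |P.z j.succ - P.z j.castSucc|

/-- The `C¹` curves on `[0,L]` that are cubic polynomials on each interval of the partition. -/
def cubicSpace {L : ℝ} (P : Partition L) : Set (ℝ → E3) :=
  {v | ContDiffOn ℝ 1 v (Icc 0 L) ∧ ∀ j : Fin P.J, ∃ p : Fin 3 → ℝ[X],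
    (∀ i, (p i).natDegree ≤ 3) ∧
    ∀ x ∈ Icc (P.z j.castSucc) (P.z j.succ), ∀ i, v x i = (p i).eval x}

/-- The discrete admissible curves: `C¹` piecewise cubic curves `v` with `|v'(z_j)|² = 1` and
`Φ(v(z_j)) = 0` at all nodes and with `B v = b`. -/
def discreteAdmissible {L : ℝ} (P : Partition L) (Φ : E3 → ℝ) {l : ℕ}
    (B : H2 L →L[ℝ] EuclideanSpace ℝ (Fin l)) (b : EuclideanSpace ℝ (Fin l)) : Set (H2 L) :=
  {u | (∃ v ∈ cubicSpace P, IsC1Rep u v ∧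
      ∀ j, ‖derivWithin v (Icc 0 L) (P.z j)‖ ^ 2 = 1 ∧ Φ (v (P.z j)) = 0) ∧ B u = b}

/-- `1/2 ∫_0^L |u''|² - γ |u'' · n(u)|² dx` with `n = ∇Φ / |∇Φ|`. -/
def bending {L : ℝ} (γ : ℝ) (Φ : E3 → ℝ) (u : H2 L) : ℝ :=
  (1 / 2) * ∫ x in Ioo (0 : ℝ) L,
    (‖D 2 u x‖ ^ 2 - γ * |inner ℝ (D 2 u x) (unitNormal Φ (D 0 u x))| ^ 2)

open Classical in
/-- The functional `I_γ`, with value `+∞` outside the admissible set. -/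
def energy {L : ℝ} (γ : ℝ) (Φ : E3 → ℝ) {l : ℕ} (B : H2 L →L[ℝ] EuclideanSpace ℝ (Fin l))
    (b : EuclideanSpace ℝ (Fin l)) (u : H2 L) : EReal :=
  if u ∈ admissible Φ B b then (bending γ Φ u : EReal) else ⊤

open Classical in
/-- The functional `I_{γ,h}`, with value `+∞` outside the discrete admissible set. -/
def discreteEnergy {L : ℝ} (P : Partition L) (γ : ℝ) (Φ : E3 → ℝ) {l : ℕ}
    (B : H2 L →L[ℝ] EuclideanSpace ℝ (Fin l)) (b : EuclideanSpace ℝ (Fin l)) (u : H2 L) : EReal :=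
  if u ∈ discreteAdmissible P Φ B b then (bending γ Φ u : EReal) else ⊤

/-- `u k` minimizes `I k` up to an error `ε k ≥ 0`, where `ε k → 0`. -/
def IsQuasiMinimizing {X : Type*} (I : ℕ → X → EReal) (u : ℕ → X) : Prop :=
  ∃ ε : ℕ → ℝ, (∀ k, 0 ≤ ε k) ∧ Tendsto ε atTop (𝓝 0) ∧
    ∀ k v, I k (u k) ≤ I k v + (ε k : EReal)

end CurveFEM

end

open CurveFEM

/-! A curve in H² is determined by `(u(0), u'(0), u'')`, and conversely every triple in ℝ³ × ℝ³ × L²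
arises (`build`, `build_eta`). This rests on the lemma of du Bois-Reymond. In these coordinates the
bending energy is ½⟨u'', A_u u''⟩ with A_u w = w - γ (n·w) n, a symmetric operator bounded below by
1 - γ, where n is the normal field along u.

Compactness: an energy bound controls u'' in L², the constraint at the node 0 gives |u'(0)| = 1, and
u(0) is controlled by `B u` because `B` is injective on constant curves, their second derivative
being zero (`exists_norm_value0_le`). Weak limits are admissible because u and u' are Hölder
continuous with exponent 1/2, uniformly along the sequence, so that constraints at the nodes become
constraints everywhere as the mesh size vanishes (`WeakTendsto.mem_admissible`).

Lower semicontinuity: weak convergence implies pointwise convergence of the curves. The limit lies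
in the surface, where n is continuous, so A_{u_k} w → A_u w in L² for each fixed w by dominated
convergence. Positivity of A_{u_k} gives ½⟨w_k, A_{u_k} w_k⟩ ≥ ⟨w_k, A_{u_k} w⟩ - ½⟨w, A_{u_k} w⟩
for w_k = u_k'' and w = u'', and the right side tends to ½⟨w, A_u w⟩.

Recovery: replacing u'' by its L² projection onto discontinuous piecewise affine functions, with
u(0) and u'(0) kept, produces the cubic Hermite interpolant. The projection error is orthogonal to 1
and x on each [0, z_i], which is exactly what preserves u' and u at the nodes. Strong H² convergence
is then convergence of the projections. Minimality of limits of quasiminimizers follows by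
comparison with recovery sequences. -/

noncomputable section

namespace CurveFEM

/-! ### Integration by parts and primitives of L² functions -/

/-- Integration by parts against a Lebesgue primitive. -/
theorem integral_deriv_smul_primitive {f : ℝ → E3} {X : ℝ} (hf : IntervalIntegrable f volume 0 X)
    {ψ : ℝ → ℝ} (hψ : ContDiff ℝ 1 ψ) :
    ∫ x in (0 : ℝ)..X, deriv ψ x • (∫ t in (0 : ℝ)..x, f t) =
      ψ X • (∫ t in (0 : ℝ)..X, f t) - ∫ x in (0 : ℝ)..X, ψ x • f x := by
  have hF : ContinuousOn (fun x => ∫ t in (0 : ℝ)..x, f t) (uIcc 0 X) :=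
    intervalIntegral.continuousOn_primitive_interval' hf left_mem_uIcc
  have hi1 : IntervalIntegrable (fun x => deriv ψ x • (∫ t in (0 : ℝ)..x, f t)) volume 0 X :=
    ((hψ.continuous_deriv le_rfl).continuousOn.smul hF).intervalIntegrable
  have hi2 : IntervalIntegrable (fun x => ψ x • f x) volume 0 X :=
    hf.continuousOn_smul hψ.continuous.continuousOn
  -- Pairing with a fixed vector reduces the claim to integration by parts for scalar absolutely
  -- continuous functions.
  refine ext_inner_left ℝ fun v => ?_
  have hfv : IntervalIntegrable (fun x => inner ℝ v (f x)) volume 0 X := by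
    rw [intervalIntegrable_iff] at hf ⊢
    exact hf.const_inner v
  have hsub : ∀ x ∈ uIcc 0 X,
      ∫ t in (0 : ℝ)..x, inner ℝ v (f t) = inner ℝ v (∫ t in (0 : ℝ)..x, f t) := fun x hx =>
    (innerSL ℝ v).intervalIntegral_comp_comm
      (hf.mono_set (uIcc_subset_uIcc left_mem_uIcc hx))
  have hac := hfv.absolutelyContinuousOnInterval_intervalIntegral (c := 0) left_mem_uIcc
  have hψac : AbsolutelyContinuousOnInterval ψ 0 X :=
    hψ.contDiffOn.absolutelyContinuousOnInterval
  have key := hψac.integral_mul_deriv_eq_deriv_mul hac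
  rw [intervalIntegral.integral_same, mul_zero, sub_zero, hsub X right_mem_uIcc] at key
  have e1 : ∫ x in (0 : ℝ)..X, ψ x * deriv (fun x => ∫ t in (0 : ℝ)..x, inner ℝ v (f t)) x =
      inner ℝ v (∫ x in (0 : ℝ)..X, ψ x • f x) := by
    rw [← innerSL_apply_apply ℝ, ← (innerSL ℝ v).intervalIntegral_comp_comm hi2]
    refine intervalIntegral.integral_congr_ae ?_
    filter_upwards [hfv.ae_hasDerivAt_integral] with x hx hx'
    rw [(hx (uIoc_subset_uIcc hx') 0 left_mem_uIcc).deriv]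
    simp
  have e2 : ∫ x in (0 : ℝ)..X, deriv ψ x * (∫ t in (0 : ℝ)..x, inner ℝ v (f t)) =
      inner ℝ v (∫ x in (0 : ℝ)..X, deriv ψ x • (∫ t in (0 : ℝ)..x, f t)) := by
    rw [← innerSL_apply_apply ℝ, ← (innerSL ℝ v).intervalIntegral_comp_comm hi1]
    refine intervalIntegral.integral_congr fun x hx => ?_
    simp only [hsub x hx, innerSL_apply_apply, inner_smul_right]
  rw [inner_sub_right, inner_smul_right, ← e2, ← e1]
  linarith

/-- Extension by zero of an `L²` function to the whole line. -/
def ext {L : ℝ} (f : L2 L) : ℝ → E3 := (Ioo (0 : ℝ) L).indicator f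

theorem memLp_ext {L : ℝ} (f : L2 L) : MemLp (ext f) 2 volume :=
  (memLp_indicator_iff_restrict measurableSet_Ioo).2 (Lp.memLp f)

theorem integrable_ext {L : ℝ} (f : L2 L) : Integrable (ext f) :=
  (integrable_indicator_iff measurableSet_Ioo).2 ((Lp.memLp f).integrable one_le_two)

theorem intervalIntegrable_ext {L : ℝ} (f : L2 L) (x y : ℝ) :
    IntervalIntegrable (ext f) volume x y :=
  (integrable_ext f).intervalIntegrable

theorem ext_congr {L : ℝ} {f : L2 L} {g : ℝ → E3}
    (h : f =ᵐ[volume.restrict (Ioo (0 : ℝ) L)] g) :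
    ext f =ᵐ[volume] (Ioo (0 : ℝ) L).indicator g := by
  filter_upwards [(ae_restrict_iff' measurableSet_Ioo).1 h] with x hx
  by_cases hx' : x ∈ Ioo (0 : ℝ) L
  · rw [ext, indicator_of_mem hx', indicator_of_mem hx', hx hx']
  · rw [ext, indicator_of_notMem hx', indicator_of_notMem hx']

theorem ext_add {L : ℝ} (f g : L2 L) : ext (f + g) =ᵐ[volume] fun x => ext f x + ext g x := by
  filter_upwards [ext_congr (Lp.coeFn_add f g)] with x hx
  rw [hx, indicator_add']; rfl

theorem ext_smul {L : ℝ} (c : ℝ) (f : L2 L) : ext (c • f) =ᵐ[volume] fun x => c • ext f x := by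
  filter_upwards [ext_congr (Lp.coeFn_smul c f)] with x hx
  rw [hx]
  simp only [ext, indicator, Pi.smul_apply]
  split_ifs <;> simp

theorem eLpNorm_ext {L : ℝ} (f : L2 L) : eLpNorm (ext f) 2 volume = ENNReal.ofReal ‖f‖ := by
  rw [ext, eLpNorm_indicator_eq_eLpNorm_restrict measurableSet_Ioo, Lp.norm_def,
    ENNReal.ofReal_toReal (Lp.eLpNorm_ne_top f)]

/-- The primitive `x ↦ ∫_0^x f` of an `L²` function. -/
def prim {L : ℝ} (f : L2 L) (x : ℝ) : E3 := ∫ t in (0 : ℝ)..x, ext f t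

theorem prim_zero {L : ℝ} (f : L2 L) : prim f 0 = 0 := by simp [prim]

theorem prim_sub_prim {L : ℝ} (f : L2 L) (x y : ℝ) :
    prim f y - prim f x = ∫ t in x..y, ext f t :=
  intervalIntegral.integral_interval_sub_left (intervalIntegrable_ext f _ _)
    (intervalIntegrable_ext f _ _)

/-- The Cauchy–Schwarz inequality on the interval between x and y. This is the source of all Hölder
estimates for curves. -/
theorem norm_prim_sub_prim_le {L : ℝ} (f : L2 L) (x y : ℝ) :
    ‖prim f y - prim f x‖ ≤ √|y - x| * ‖f‖ := by
  rw [prim_sub_prim, intervalIntegral.norm_intervalIntegral_eq]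
  have h1 : ‖∫ t in uIoc x y, ext f t‖ₑ ≤ ENNReal.ofReal (√|y - x| * ‖f‖) := by
    calc ‖∫ t in uIoc x y, ext f t‖ₑ ≤ ∫⁻ t in uIoc x y, ‖ext f t‖ₑ :=
          enorm_integral_le_lintegral_enorm _
      _ = eLpNorm (ext f) 1 (volume.restrict (uIoc x y)) := eLpNorm_one_eq_lintegral_enorm.symm
      _ ≤ eLpNorm (ext f) 2 (volume.restrict (uIoc x y)) *
          volume.restrict (uIoc x y) univ ^ (1 / (1 : ENNReal).toReal - 1 / (2 : ENNReal).toReal) :=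
          eLpNorm_le_eLpNorm_mul_rpow_measure_univ one_le_two
            (memLp_ext f).aestronglyMeasurable.restrict
      _ ≤ ENNReal.ofReal ‖f‖ * ENNReal.ofReal √|y - x| := by
          gcongr
          · exact (eLpNorm_mono_measure _ Measure.restrict_le_self).trans (eLpNorm_ext f).le
          · rw [Measure.restrict_apply_univ, Real.volume_uIoc,
              ENNReal.ofReal_rpow_of_nonneg (abs_nonneg _) (by norm_num), Real.sqrt_eq_rpow]
            norm_num
      _ = ENNReal.ofReal (√|y - x| * ‖f‖) := by
          rw [mul_comm, ENNReal.ofReal_mul (by positivity)]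
  rw [← ofReal_norm, ENNReal.ofReal_le_ofReal_iff (by positivity)] at h1
  exact h1

theorem continuous_prim {L : ℝ} (f : L2 L) : Continuous (prim f) :=
  intervalIntegral.continuous_primitive (fun _ _ => intervalIntegrable_ext f _ _) 0

/-- Evaluation of the primitive at a point, as a continuous linear map. -/
def primL {L : ℝ} (x : ℝ) : L2 L →L[ℝ] E3 :=
  LinearMap.mkContinuous
    { toFun := fun f => prim f x
      map_add' := fun f g => by
        rw [prim, intervalIntegral.integral_congr_ae ((ext_add f g).mono fun _ h _ => h),
          intervalIntegral.integral_add (intervalIntegrable_ext f _ _)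
            (intervalIntegrable_ext g _ _)]
        rfl
      map_smul' := fun c f => by
        rw [prim, intervalIntegral.integral_congr_ae ((ext_smul c f).mono fun _ h _ => h),
          intervalIntegral.integral_smul]
        rfl }
    √|x| fun f => by simpa [prim_zero] using norm_prim_sub_prim_le f 0 x

theorem primL_apply {L : ℝ} (x : ℝ) (f : L2 L) : primL x f = prim f x := rfl

theorem norm_prim_le {L : ℝ} (f : L2 L) (x : ℝ) : ‖prim f x‖ ≤ √|x| * ‖f‖ := by
  simpa [prim_zero] using norm_prim_sub_prim_le f 0 x

theorem intervalIntegral_eq_setIntegral_Ioo {L : ℝ} (hL : 0 < L) (f g : ℝ → E3)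
    (h : ∀ x ∈ Ioo (0 : ℝ) L, f x = g x) : ∫ x in (0 : ℝ)..L, f x = ∫ x in Ioo (0 : ℝ) L, g x := by
  rw [intervalIntegral.integral_of_le hL.le, integral_Ioc_eq_integral_Ioo]
  exact setIntegral_congr_fun measurableSet_Ioo h

/-- Continuous functions as elements of `L²(0,L)`. -/
theorem memLp_of_continuous {L : ℝ} {f : ℝ → E3} (hf : Continuous f) :
    MemLp f 2 (volume.restrict (Ioo (0 : ℝ) L)) := by
  obtain ⟨C, hC⟩ := isCompact_Icc.exists_bound_of_continuousOn (hf.continuousOn (s := Icc 0 L))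
  refine MemLp.of_bound hf.aestronglyMeasurable C ?_
  filter_upwards [ae_restrict_mem measurableSet_Ioo] with x hx
  exact hC x (Ioo_subset_Icc_self hx)

/-- The Volterra operator `f ↦ ∫_0^x f` on `L²(0,L)`. -/
def volterra (L : ℝ) : L2 L →L[ℝ] L2 L :=
  LinearMap.mkContinuous
    { toFun := fun f => (memLp_of_continuous (continuous_prim f)).toLp (prim f)
      map_add' := fun f g => by
        rw [← MemLp.toLp_add]
        congr 1
        ext1 x
        exact (primL x).map_add f g
      map_smul' := fun c f => by
        rw [RingHom.id_apply, ← MemLp.toLp_const_smul]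
        congr 1
        ext1 x
        exact (primL x).map_smul c f }
    ((measureUnivNNReal (volume.restrict (Ioo (0 : ℝ) L)) : ℝ) ^ (2 : ENNReal).toReal⁻¹ * √|L|)
    fun f => by
      have h := Lp.norm_le_of_ae_bound (p := 2)
        (f := (memLp_of_continuous (L := L) (continuous_prim f)).toLp (prim f))
        (C := √|L| * ‖f‖) (by positivity) (by
          filter_upwards [MemLp.coeFn_toLp (memLp_of_continuous (L := L) (continuous_prim f)),
            ae_restrict_mem measurableSet_Ioo] with x hx hx'
          rw [hx]
          refine (norm_prim_le f x).trans ?_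
          gcongr
          exacts [hx'.1.le, hx'.2.le])
      rw [mul_assoc]
      exact h

theorem volterra_ae {L : ℝ} (f : L2 L) :
    volterra L f =ᵐ[volume.restrict (Ioo (0 : ℝ) L)] prim f :=
  MemLp.coeFn_toLp (memLp_of_continuous (continuous_prim f))

/-- Constant functions in `L²(0,L)`. -/
def constL (L : ℝ) : E3 →L[ℝ] L2 L := Lp.constL 2 (volume.restrict (Ioo (0 : ℝ) L)) ℝ

theorem constL_ae {L : ℝ} (a : E3) :
    constL L a =ᵐ[volume.restrict (Ioo (0 : ℝ) L)] fun _ => a :=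
  Lp.coeFn_const ..

/-! ### Weak derivatives and the lemma of du Bois-Reymond -/

theorem IsTest.eq_zero {L : ℝ} {φ : ℝ → ℝ} (h : IsTest L φ) {x : ℝ} (hx : x ∉ Ioo (0 : ℝ) L) :
    φ x = 0 :=
  image_eq_zero_of_notMem_tsupport fun h' => hx (h.2.2 h')

theorem ext_of_mem {L : ℝ} (f : L2 L) {x : ℝ} (hx : x ∈ Ioo (0 : ℝ) L) : ext f x = f x :=
  indicator_of_mem hx _

theorem isWeakDeriv_volterra {L : ℝ} (hL : 0 < L) (f : L2 L) : IsWeakDeriv (volterra L f) f := by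
  intro φ hφ
  have h := integral_deriv_smul_primitive (intervalIntegrable_ext f 0 L) (hφ.1.of_le (by simp))
  rw [hφ.eq_zero (by simp), zero_smul, zero_sub, intervalIntegral_eq_setIntegral_Ioo hL
    (fun x => φ x • ext f x) (fun x => φ x • f x) fun x hx => by rw [ext_of_mem f hx],
    intervalIntegral_eq_setIntegral_Ioo hL (fun x => deriv φ x • ∫ t in (0 : ℝ)..x, ext f t)
    (fun x => deriv φ x • prim f x) fun x hx => rfl] at h
  rw [← h]
  refine integral_congr_ae ?_
  filter_upwards [volterra_ae f] with x hx
  rw [hx]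

theorem IsTest.integral_deriv {L : ℝ} (hL : 0 < L) {φ : ℝ → ℝ} (hφ : IsTest L φ) :
    ∫ x in Ioo (0 : ℝ) L, deriv φ x = 0 := by
  rw [← integral_Ioc_eq_integral_Ioo, ← intervalIntegral.integral_of_le hL.le,
    intervalIntegral.integral_deriv_eq_sub
      (fun x _ => (hφ.1.differentiable (by simp)).differentiableAt)
      hφ.continuous_deriv.continuousOn.intervalIntegrable, hφ.eq_zero (by simp),
    hφ.eq_zero (by simp), sub_zero]

theorem isWeakDeriv_constL {L : ℝ} (hL : 0 < L) (a : E3) : IsWeakDeriv (constL L a) 0 := by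
  intro φ hφ
  have h0 : ∫ x in Ioo (0 : ℝ) L, φ x • (0 : L2 L) x = 0 := by
    have := integral_smul_smul_L2 0 (0 : L2 L) φ
    simpa using this
  have h1 : ∫ x in Ioo (0 : ℝ) L, deriv φ x • constL L a x =
      ∫ x in Ioo (0 : ℝ) L, deriv φ x • a := by
    refine integral_congr_ae ?_
    filter_upwards [constL_ae (L := L) a] with x hx
    rw [hx]
  rw [h0, h1, integral_smul_const, hφ.integral_deriv hL, zero_smul, neg_zero]

/-- A test function of vanishing mean is the derivative of a test function. -/
theorem IsTest.exists_deriv_eq {L : ℝ} (hL : 0 < L) {θ : ℝ → ℝ} (hθ : IsTest L θ)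
    (h0 : ∫ x, θ x = 0) : ∃ φ, IsTest L φ ∧ deriv φ = θ := by
  have hd : ∀ x, HasDerivAt (fun x => ∫ t in (0 : ℝ)..x, θ t) (θ x) x := fun x =>
    intervalIntegral.integral_hasDerivAt_right (hθ.continuous.intervalIntegrable _ _)
      (hθ.continuous.stronglyMeasurableAtFilter _ _) hθ.continuous.continuousAt
  have hd' : deriv (fun x => ∫ t in (0 : ℝ)..x, θ t) = θ := funext fun x => (hd x).deriv
  -- The midpoint is added so that the set is nonempty even for θ = 0; its minimum α and maximum β
  -- then exist.
  have hK : IsCompact (tsupport θ ∪ {L / 2}) := (hθ.2.1 : IsCompact _).union isCompact_singleton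
  have hne : (tsupport θ ∪ {L / 2}).Nonempty := ⟨L / 2, by simp⟩
  have hKs : tsupport θ ∪ {L / 2} ⊆ Ioo 0 L :=
    union_subset hθ.2.2 (by simp [hL])
  obtain ⟨α, hα, hαl⟩ := hK.exists_isLeast hne
  obtain ⟨β, hβ, hβu⟩ := hK.exists_isGreatest hne
  have hout : ∀ t, t ∉ Icc α β → θ t = 0 := fun t ht =>
    image_eq_zero_of_notMem_tsupport fun h => ht ⟨hαl (Or.inl h), hβu (Or.inl h)⟩
  have hsupp : ∀ x, x ∉ Icc α β → ∫ t in (0 : ℝ)..x, θ t = 0 := by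
    intro x hx
    -- To the left of α the integrand vanishes between 0 and x; to the right of β the integral
    -- already collects the whole mass of θ, which is zero.
    rcases lt_or_ge x α with h | h
    · rw [intervalIntegral.integral_congr (g := fun _ => (0 : ℝ)), intervalIntegral.integral_zero]
      intro t ht
      refine hout t fun ht' => ?_
      have h1 : t ≤ max 0 x := ht.2
      have h2 := (hKs hα).1
      exact absurd (ht'.1.trans h1) (not_le.2 (max_lt h2 h))
    · have hxβ : β < x := lt_of_not_ge fun h' => hx ⟨h, h'⟩
      have h1 := (hKs hα).1
      have h2 : α ≤ β := hαl hβ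
      rw [intervalIntegral.integral_of_le (by linarith)]
      refine (setIntegral_eq_integral_of_forall_compl_eq_zero fun t ht =>
        hout t fun ht' => ht ?_).trans h0
      exact ⟨h1.trans_le ht'.1, ht'.2.trans hxβ.le⟩
  have hts : tsupport (fun x => ∫ t in (0 : ℝ)..x, θ t) ⊆ Icc α β :=
    closure_minimal (fun x hx => by_contra fun h => hx (hsupp x h)) isClosed_Icc
  refine ⟨_, ⟨?_, isCompact_Icc.of_isClosed_subset (isClosed_tsupport _) hts, hts.trans ?_⟩, hd'⟩
  · rw [contDiff_infty_iff_deriv, hd']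
    exact ⟨fun x => (hd x).differentiableAt, hθ.1⟩
  · exact fun x hx => ⟨(hKs hα).1.trans_le hx.1, hx.2.trans_lt (hKs hβ).2⟩

theorem exists_isTest_integral_eq_one {L : ℝ} (hL : 0 < L) : ∃ ψ, IsTest L ψ ∧ ∫ x, ψ x = 1 := by
  let f : ContDiffBump (L / 2) := ⟨L / 8, L / 4, by linarith, by linarith⟩
  refine ⟨f.normed volume, ⟨f.contDiff_normed, f.hasCompactSupport_normed, ?_⟩, f.integral_normed⟩
  rw [f.tsupport_normed_eq, Real.closedBall_eq_Icc]
  intro x hx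
  have h1 : L / 2 - L / 4 ≤ x := hx.1
  have h2 : x ≤ L / 2 + L / 4 := hx.2
  constructor <;> linarith

/-- The lemma of du Bois-Reymond. -/
theorem exists_eq_constL_of_isWeakDeriv_zero {L : ℝ} (hL : 0 < L) {f : L2 L}
    (hf : IsWeakDeriv f 0) : ∃ a, f = constL L a := by
  obtain ⟨ψ, hψ, hψ1⟩ := exists_isTest_integral_eq_one hL
  have h0 : ∀ φ : ℝ → ℝ, ∫ x in Ioo (0 : ℝ) L, φ x • (0 : L2 L) x = 0 := fun φ => by
    have := integral_smul_smul_L2 0 (0 : L2 L) φ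
    simpa using this
  set a : E3 := ∫ x in Ioo (0 : ℝ) L, ψ x • f x
  have hint : ∀ η : ℝ → ℝ, IsTest L η → Integrable η := fun η hη =>
    hη.continuous.integrable_of_hasCompactSupport hη.2.1
  have key : ∀ η, IsTest L η → ∫ x in Ioo (0 : ℝ) L, η x • f x = (∫ x, η x) • a := by
    intro η hη
    set m := ∫ x, η x
    -- Subtracting m ψ removes the mean, so the difference is the derivative of a test function and
    -- may be inserted into the weak equation.
    have hθ : IsTest L (fun x => η x - m * ψ x) := by
      refine ⟨hη.1.sub (contDiff_const.mul hψ.1), hη.2.1.sub hψ.2.1.mul_left, ?_⟩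
      refine (tsupport_sub η _).trans (union_subset hη.2.2 ?_)
      exact (tsupport_mul_subset_right (f := fun _ => m)).trans hψ.2.2
    obtain ⟨φ, hφ, hφd⟩ := hθ.exists_deriv_eq hL (by
      rw [integral_sub (hint η hη) ((hint ψ hψ).const_mul m), integral_const_mul, hψ1, mul_one,
        sub_self])
    have h1 := hf φ hφ
    rw [h0, hφd, neg_zero] at h1
    simp only [sub_smul, mul_smul] at h1
    rw [integral_sub (integrable_smul_L2 f hη.continuous hη.2.1)
      ((integrable_smul_L2 f hψ.continuous hψ.2.1).fun_smul m), integral_smul, sub_eq_zero] at h1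
    exact h1
  refine ⟨a, ?_⟩
  have hz : ∀ᵐ x ∂volume, x ∈ Ioo (0 : ℝ) L → f x - a = 0 := by
    refine isOpen_Ioo.ae_eq_zero_of_integral_contDiff_smul_eq_zero ?_ ?_
    · have h1 : IntegrableOn (fun x => f x - a) (Ioo 0 L) :=
        ((Lp.memLp f).integrable one_le_two).sub (integrable_const a)
      exact h1.locallyIntegrableOn
    · intro η h1 h2 h3
      have hη : IsTest L η := ⟨h1, h2, h3⟩
      have hzero : ∀ x, x ∉ Ioo (0 : ℝ) L → η x = 0 := fun x hx => hη.eq_zero hx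
      rw [← setIntegral_eq_integral_of_forall_compl_eq_zero (s := Ioo (0 : ℝ) L)
        fun x hx => by rw [hzero x hx, zero_smul]]
      simp only [smul_sub]
      rw [integral_sub (integrable_smul_L2 f hη.continuous hη.2.1)
        ((hint η hη).restrict.smul_const a), key η hη, integral_smul_const,
        setIntegral_eq_integral_of_forall_compl_eq_zero hzero, sub_self]
  refine Lp.ext ?_
  filter_upwards [constL_ae (L := L) a, (ae_restrict_iff' measurableSet_Ioo).2 hz] with x h1 h2
  rw [h1, sub_eq_zero.1 h2]

/-- The difference of f and the primitive of g has weak derivative zero, hence is constant. -/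
theorem IsWeakDeriv.exists_eq_volterra_add {L : ℝ} (hL : 0 < L) {f g : L2 L}
    (h : IsWeakDeriv f g) : ∃ a, f = volterra L g + constL L a := by
  obtain ⟨a, ha⟩ := exists_eq_constL_of_isWeakDeriv_zero hL (f := f + (-1 : ℝ) • volterra L g) (by
    simpa using h.add ((isWeakDeriv_volterra hL g).smul (-1)))
  exact ⟨a, by rw [← ha]; simp⟩

theorem prim_eq_of_ae {L : ℝ} {f : L2 L} {g : ℝ → E3}
    (h : f =ᵐ[volume.restrict (Ioo (0 : ℝ) L)] g) {x : ℝ} (hx : x ∈ Icc 0 L) :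
    prim f x = ∫ t in (0 : ℝ)..x, g t := by
  rw [prim, intervalIntegral.integral_of_le hx.1, intervalIntegral.integral_of_le hx.1,
    integral_Ioc_eq_integral_Ioo, integral_Ioc_eq_integral_Ioo]
  refine setIntegral_congr_ae measurableSet_Ioo ?_
  filter_upwards [ext_congr h] with t ht htx
  rw [ht, indicator_of_mem (Ioo_subset_Ioo_right hx.2 htx)]

theorem prim_constL {L : ℝ} (a : E3) {x : ℝ} (hx : x ∈ Icc 0 L) :
    prim (constL L a) x = x • a := by
  rw [prim_eq_of_ae (constL_ae a) hx]
  simp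

/-! ### Initial value, initial slope and second derivative as coordinates on H² -/

/-- The mean value over `(0,L)`. -/
def meanL (L : ℝ) : L2 L →L[ℝ] E3 := L⁻¹ • primL L

/-- The mean recovers the constant of integration, which makes `value0` and `slope0` continuous
linear maps by construction. -/
theorem meanL_constL {L : ℝ} (hL : 0 < L) (a : E3) : meanL L (constL L a) = a := by
  rw [meanL, smul_apply, primL_apply, prim_constL a ⟨hL.le, le_rfl⟩,
    smul_smul, inv_mul_cancel₀ hL.ne', one_smul]

/-- The `k`-th weak derivative as a continuous linear map. -/
def DL {L : ℝ} (k : Fin 3) : H2 L →L[ℝ] L2 L :=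
  (PiLp.proj 2 (fun _ : Fin 3 => L2 L) k : _ →L[ℝ] L2 L).comp (H2 L).subtypeL

theorem DL_apply {L : ℝ} (k : Fin 3) (u : H2 L) : DL k u = D k u := rfl

/-- The initial value `u(0)`. -/
def value0 (L : ℝ) : H2 L →L[ℝ] E3 := (meanL L).comp (DL 0 - (volterra L).comp (DL 1))

/-- The initial slope `u'(0)`. -/
def slope0 (L : ℝ) : H2 L →L[ℝ] E3 := (meanL L).comp (DL 1 - (volterra L).comp (DL 2))

theorem D_one_eq {L : ℝ} (hL : 0 < L) (u : H2 L) :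
    D 1 u = volterra L (D 2 u) + constL L (slope0 L u) := by
  obtain ⟨a, ha⟩ := u.2.2.exists_eq_volterra_add hL
  have ha' : D 1 u = volterra L (D 2 u) + constL L a := ha
  have : slope0 L u = a := by
    change meanL L (D 1 u - volterra L (D 2 u)) = a
    rw [ha', add_sub_cancel_left, meanL_constL hL]
  rw [this, ha']

theorem D_zero_eq {L : ℝ} (hL : 0 < L) (u : H2 L) :
    D 0 u = volterra L (D 1 u) + constL L (value0 L u) := by
  obtain ⟨a, ha⟩ := u.2.1.exists_eq_volterra_add hL
  have ha' : D 0 u = volterra L (D 1 u) + constL L a := ha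
  have : value0 L u = a := by
    change meanL L (D 0 u - volterra L (D 1 u)) = a
    rw [ha', add_sub_cancel_left, meanL_constL hL]
  rw [this, ha']

/-- The curve with initial value `a`, initial slope `c` and second derivative `w`. -/
def build {L : ℝ} (hL : 0 < L) : (E3 × E3 × L2 L) →L[ℝ] H2 L :=
  ContinuousLinearMap.codRestrict
    ((PiLp.continuousLinearEquiv 2 ℝ (fun _ : Fin 3 => L2 L)).symm.toContinuousLinearMap.comp
      (ContinuousLinearMap.pi
        ![(volterra L).comp ((volterra L).comp
            ((ContinuousLinearMap.snd ℝ E3 (L2 L)).comp (ContinuousLinearMap.snd ℝ E3 _)) +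
            (constL L).comp
              ((ContinuousLinearMap.fst ℝ E3 (L2 L)).comp (ContinuousLinearMap.snd ℝ E3 _))) +
            (constL L).comp (ContinuousLinearMap.fst ℝ E3 _),
          (volterra L).comp
            ((ContinuousLinearMap.snd ℝ E3 (L2 L)).comp (ContinuousLinearMap.snd ℝ E3 _)) +
            (constL L).comp
              ((ContinuousLinearMap.fst ℝ E3 (L2 L)).comp (ContinuousLinearMap.snd ℝ E3 _)),
          (ContinuousLinearMap.snd ℝ E3 (L2 L)).comp (ContinuousLinearMap.snd ℝ E3 _)]))
    (H2 L) (by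
      rintro ⟨a, c, w⟩
      constructor
      · change IsWeakDeriv (volterra L (volterra L w + constL L c) + constL L a)
          (volterra L w + constL L c)
        simpa using (isWeakDeriv_volterra hL (volterra L w + constL L c)).add
          (isWeakDeriv_constL hL a)
      · change IsWeakDeriv (volterra L w + constL L c) w
        simpa using (isWeakDeriv_volterra hL w).add (isWeakDeriv_constL hL c))

theorem D_two_build {L : ℝ} (hL : 0 < L) (a c : E3) (w : L2 L) : D 2 (build hL (a, c, w)) = w := rfl

theorem D_one_build {L : ℝ} (hL : 0 < L) (a c : E3) (w : L2 L) :
    D 1 (build hL (a, c, w)) = volterra L w + constL L c := rfl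

theorem D_zero_build {L : ℝ} (hL : 0 < L) (a c : E3) (w : L2 L) :
    D 0 (build hL (a, c, w)) = volterra L (volterra L w + constL L c) + constL L a := rfl

theorem slope0_build {L : ℝ} (hL : 0 < L) (a c : E3) (w : L2 L) :
    slope0 L (build hL (a, c, w)) = c := by
  change meanL L (D 1 (build hL (a, c, w)) - volterra L (D 2 (build hL (a, c, w)))) = c
  rw [D_two_build, D_one_build, add_sub_cancel_left, meanL_constL hL]

theorem value0_build {L : ℝ} (hL : 0 < L) (a c : E3) (w : L2 L) :
    value0 L (build hL (a, c, w)) = a := by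
  change meanL L (D 0 (build hL (a, c, w)) - volterra L (D 1 (build hL (a, c, w)))) = a
  rw [D_zero_build, D_one_build, add_sub_cancel_left, meanL_constL hL]

theorem build_eta {L : ℝ} (hL : 0 < L) (u : H2 L) :
    build hL (value0 L u, slope0 L u, D 2 u) = u := by
  refine Subtype.ext (PiLp.ext fun k => ?_)
  change D k (build hL (value0 L u, slope0 L u, D 2 u)) = D k u
  fin_cases k
  · change D 0 _ = D 0 u
    rw [D_zero_build, ← D_one_eq hL, ← D_zero_eq hL]
  · change D 1 _ = D 1 u
    rw [D_one_build, ← D_one_eq hL]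
  · rfl

/-! ### Continuously differentiable representatives -/

/-- The continuous representative of `u'`. -/
def rep1 {L : ℝ} (u : H2 L) (x : ℝ) : E3 := slope0 L u + prim (D 2 u) x

/-- The continuously differentiable representative of `u`. -/
def rep0 {L : ℝ} (u : H2 L) (x : ℝ) : E3 := value0 L u + ∫ t in (0 : ℝ)..x, rep1 u t

theorem continuous_rep1 {L : ℝ} (u : H2 L) : Continuous (rep1 u) :=
  continuous_const.add (continuous_prim _)

theorem hasDerivAt_rep0 {L : ℝ} (u : H2 L) (x : ℝ) : HasDerivAt (rep0 u) (rep1 u x) x :=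
  (intervalIntegral.integral_hasDerivAt_right ((continuous_rep1 u).intervalIntegrable _ _)
    ((continuous_rep1 u).stronglyMeasurableAtFilter _ _)
    (continuous_rep1 u).continuousAt).const_add _

theorem continuous_rep0 {L : ℝ} (u : H2 L) : Continuous (rep0 u) :=
  continuous_iff_continuousAt.2 fun x => (hasDerivAt_rep0 u x).continuousAt

theorem contDiff_rep0 {L : ℝ} (u : H2 L) : ContDiff ℝ 1 (rep0 u) := by
  rw [contDiff_one_iff_deriv]
  refine ⟨fun x => (hasDerivAt_rep0 u x).differentiableAt, ?_⟩
  rw [show deriv (rep0 u) = rep1 u from funext fun x => (hasDerivAt_rep0 u x).deriv]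
  exact continuous_rep1 u

theorem D_one_ae {L : ℝ} (hL : 0 < L) (u : H2 L) :
    D 1 u =ᵐ[volume.restrict (Ioo (0 : ℝ) L)] rep1 u := by
  rw [D_one_eq hL]
  filter_upwards [Lp.coeFn_add (volterra L (D 2 u)) (constL L (slope0 L u)),
    volterra_ae (D 2 u), constL_ae (L := L) (slope0 L u)] with x h1 h2 h3
  rw [h1, Pi.add_apply, h2, h3, add_comm, rep1]

theorem rep0_eq {L : ℝ} (hL : 0 < L) (u : H2 L) {x : ℝ} (hx : x ∈ Icc 0 L) :
    rep0 u x = value0 L u + prim (D 1 u) x := by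
  rw [rep0, prim_eq_of_ae (D_one_ae hL u) hx]

theorem D_zero_ae {L : ℝ} (hL : 0 < L) (u : H2 L) :
    D 0 u =ᵐ[volume.restrict (Ioo (0 : ℝ) L)] rep0 u := by
  rw [D_zero_eq hL]
  filter_upwards [Lp.coeFn_add (volterra L (D 1 u)) (constL L (value0 L u)),
    volterra_ae (D 1 u), constL_ae (L := L) (value0 L u), ae_restrict_mem measurableSet_Ioo]
    with x h1 h2 h3 hx
  rw [h1, Pi.add_apply, h2, h3, add_comm, rep0_eq hL u (Ioo_subset_Icc_self hx)]

theorem isC1Rep_rep0 {L : ℝ} (hL : 0 < L) (u : H2 L) : IsC1Rep u (rep0 u) :=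
  ⟨(contDiff_rep0 u).contDiffOn, D_zero_ae hL u⟩

theorem derivWithin_rep0 {L : ℝ} (hL : 0 < L) (u : H2 L) {x : ℝ} (hx : x ∈ Icc 0 L) :
    derivWithin (rep0 u) (Icc 0 L) x = rep1 u x :=
  (hasDerivAt_rep0 u x).hasDerivWithinAt.derivWithin (uniqueDiffOn_Icc hL x hx)

theorem eqOn_of_ae_eq_Ioo {L : ℝ} (hL : 0 < L) {f g : ℝ → E3} (hf : ContinuousOn f (Icc 0 L))
    (hg : ContinuousOn g (Icc 0 L)) (h : f =ᵐ[volume.restrict (Ioo (0 : ℝ) L)] g) :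
    EqOn f g (Icc 0 L) :=
  Measure.eqOn_of_ae_eq (by rwa [← Measure.restrict_congr_set (Ioo_ae_eq_Icc (μ := volume))]) hf hg
    (by rw [interior_Icc, closure_Ioo hL.ne])

theorem IsC1Rep.eqOn {L : ℝ} (hL : 0 < L) {u : H2 L} {f : ℝ → E3} (h : IsC1Rep u f) :
    EqOn f (rep0 u) (Icc 0 L) :=
  eqOn_of_ae_eq_Ioo hL h.1.continuousOn (continuous_rep0 u).continuousOn
    (h.2.symm.trans (D_zero_ae hL u))

theorem IsC1Rep.derivWithin_eq {L : ℝ} (hL : 0 < L) {u : H2 L} {f : ℝ → E3} (h : IsC1Rep u f)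
    {x : ℝ} (hx : x ∈ Icc 0 L) : derivWithin f (Icc 0 L) x = rep1 u x := by
  rw [derivWithin_congr (h.eqOn hL) (h.eqOn hL hx), derivWithin_rep0 hL u hx]

/-! ### The multiplication operator of the anisotropic energy -/

theorem norm_inner_smul_le {n : E3} (hn : ‖n‖ ≤ 1) (w : E3) : ‖inner ℝ n w • n‖ ≤ ‖w‖ := by
  rw [norm_smul]
  calc ‖inner ℝ n w‖ * ‖n‖ ≤ (‖n‖ * ‖w‖) * ‖n‖ := by gcongr; exact norm_inner_le_norm n w
    _ ≤ (1 * ‖w‖) * 1 := by gcongr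
    _ = ‖w‖ := by ring

theorem aestronglyMeasurable_inner_smul {L : ℝ} {n : ℝ → E3} (hn : Measurable n) (w : L2 L) :
    AEStronglyMeasurable (fun x => (inner ℝ (n x) (w x) : ℝ) • n x)
      (volume.restrict (Ioo (0 : ℝ) L)) := by
  have hw : AEStronglyMeasurable w (volume.restrict (Ioo (0 : ℝ) L)) := Lp.aestronglyMeasurable w
  have hn' : AEStronglyMeasurable n (volume.restrict (Ioo (0 : ℝ) L)) := hn.aestronglyMeasurable
  have h1 : AEStronglyMeasurable (fun x => (inner ℝ (n x) (w x) : ℝ))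
      (volume.restrict (Ioo (0 : ℝ) L)) := hn'.inner hw
  exact h1.smul hn'

theorem memLp_anis {L : ℝ} (γ : ℝ) {n : ℝ → E3} (hn : Measurable n) (hb : ∀ x, ‖n x‖ ≤ 1)
    (w : L2 L) :
    MemLp (fun x => w x - γ • (inner ℝ (n x) (w x) • n x)) 2 (volume.restrict (Ioo (0 : ℝ) L)) := by
  have h3 : AEStronglyMeasurable (fun x => γ • ((inner ℝ (n x) (w x) : ℝ) • n x))
      (volume.restrict (Ioo (0 : ℝ) L)) := (aestronglyMeasurable_inner_smul hn w).const_smul γ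
  refine MemLp.of_le_mul (c := 1 + |γ|) (Lp.memLp w) ((Lp.aestronglyMeasurable w).sub h3)
    (Eventually.of_forall fun x => ?_)
  calc ‖w x - γ • (inner ℝ (n x) (w x) • n x)‖
      ≤ ‖w x‖ + ‖γ • (inner ℝ (n x) (w x) • n x)‖ := norm_sub_le _ _
    _ ≤ ‖w x‖ + |γ| * ‖w x‖ := by
        rw [norm_smul, Real.norm_eq_abs]
        gcongr
        exact norm_inner_smul_le (hb x) _
    _ = (1 + |γ|) * ‖w x‖ := by ring

/-- The multiplication operator `w ↦ w - γ (n · w) n` on `L²(0,L)`. -/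
def anis {L : ℝ} (γ : ℝ) (n : ℝ → E3) (hn : Measurable n) (hb : ∀ x, ‖n x‖ ≤ 1) :
    L2 L →L[ℝ] L2 L :=
  LinearMap.mkContinuous
    { toFun := fun w => (memLp_anis γ hn hb w).toLp _
      map_add' := fun v w => by
        rw [← MemLp.toLp_add, MemLp.toLp_eq_toLp_iff]
        filter_upwards [Lp.coeFn_add v w] with x hx
        simp only [hx, Pi.add_apply, inner_add_right, add_smul, smul_add]
        abel
      map_smul' := fun c w => by
        rw [RingHom.id_apply, ← MemLp.toLp_const_smul, MemLp.toLp_eq_toLp_iff]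
        filter_upwards [Lp.coeFn_smul c w] with x hx
        simp only [hx, Pi.smul_apply, inner_smul_right, smul_sub, mul_smul]
        rw [smul_comm γ c] }
    (1 + |γ|) fun w => by
      refine Lp.norm_le_mul_norm_of_ae_le_mul ?_
      filter_upwards [MemLp.coeFn_toLp (memLp_anis γ hn hb w)] with x hx
      change ‖(memLp_anis γ hn hb w).toLp _ x‖ ≤ _
      rw [hx]
      calc ‖w x - γ • (inner ℝ (n x) (w x) • n x)‖
          ≤ ‖w x‖ + ‖γ • (inner ℝ (n x) (w x) • n x)‖ := norm_sub_le _ _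
        _ ≤ ‖w x‖ + |γ| * ‖w x‖ := by
            rw [norm_smul, Real.norm_eq_abs]
            gcongr
            exact norm_inner_smul_le (hb x) _
        _ = (1 + |γ|) * ‖w x‖ := by ring

section anis
variable {L γ : ℝ} {n : ℝ → E3} (hn : Measurable n) (hb : ∀ x, ‖n x‖ ≤ 1)

theorem anis_ae (w : L2 L) : anis γ n hn hb w =ᵐ[volume.restrict (Ioo (0 : ℝ) L)]
    fun x => w x - γ • (inner ℝ (n x) (w x) • n x) :=
  MemLp.coeFn_toLp (memLp_anis γ hn hb w)

theorem norm_anis_le (w : L2 L) : ‖anis γ n hn hb w‖ ≤ (1 + |γ|) * ‖w‖ :=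
  (anis γ n hn hb).le_of_opNorm_le (LinearMap.mkContinuous_norm_le _ (by positivity) _) w

theorem inner_anis (v w : L2 L) : inner ℝ v (anis γ n hn hb w) =
    ∫ x in Ioo (0 : ℝ) L,
      (inner ℝ (v x) (w x) - γ * (inner ℝ (v x) (n x) * inner ℝ (w x) (n x))) := by
  rw [L2.inner_def]
  refine integral_congr_ae ?_
  filter_upwards [anis_ae hn hb (γ := γ) w] with x hx
  rw [hx, inner_sub_right, inner_smul_right, inner_smul_right, real_inner_comm (w x) (n x)]
  ring

theorem inner_anis_comm (v w : L2 L) :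
    inner ℝ v (anis γ n hn hb w) = inner ℝ w (anis γ n hn hb v) := by
  rw [inner_anis, inner_anis]
  congr 1
  ext1 x
  rw [real_inner_comm (w x) (v x)]
  ring

/-- The part removed from w is γ (n·w) n, of norm at most γ ‖w‖ because |n| ≤ 1; the Cauchy–Schwarz
inequality then bounds what is lost from ‖w‖². -/
theorem le_inner_anis (hγ : 0 ≤ γ) (w : L2 L) :
    (1 - γ) * ‖w‖ ^ 2 ≤ inner ℝ w (anis γ n hn hb w) := by
  have h1 : γ * inner ℝ w w + ((1 - γ) * ‖w‖ ^ 2 - inner ℝ w (anis γ n hn hb w)) ≤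
      γ * inner ℝ w w := by
    have : γ * inner ℝ w w + ((1 - γ) * ‖w‖ ^ 2 - inner ℝ w (anis γ n hn hb w)) =
        inner ℝ w (w - anis γ n hn hb w) := by
      rw [inner_sub_right, real_inner_self_eq_norm_sq]
      ring
    rw [this, real_inner_self_eq_norm_sq]
    calc inner ℝ w (w - anis γ n hn hb w) ≤ ‖w‖ * ‖w - anis γ n hn hb w‖ :=
          real_inner_le_norm _ _
      _ ≤ ‖w‖ * (γ * ‖w‖) := by
          gcongr
          refine Lp.norm_le_mul_norm_of_ae_le_mul ?_
          filter_upwards [Lp.coeFn_sub w (anis γ n hn hb w), anis_ae hn hb (γ := γ) w]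
            with x h1 h2
          rw [h1, Pi.sub_apply, h2, sub_sub_cancel, norm_smul, Real.norm_of_nonneg hγ]
          gcongr
          exact norm_inner_smul_le (hb x) _
      _ = γ * ‖w‖ ^ 2 := by ring
  linarith

end anis

theorem norm_inner_smul_sub_le {m n : E3} (hm : ‖m‖ ≤ 1) (hn : ‖n‖ ≤ 1) (w : E3) :
    ‖inner ℝ m w • m - inner ℝ n w • n‖ ≤ 2 * ‖w‖ := by
  linarith [norm_sub_le (inner ℝ m w • m) (inner ℝ n w • n), norm_inner_smul_le hm w,
    norm_inner_smul_le hn w]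

/-- Strong convergence of the multiplication operators under pointwise convergence. -/
theorem tendsto_anis {L γ : ℝ} {N : ℕ → ℝ → E3} {n : ℝ → E3} (hN : ∀ k, Measurable (N k))
    (hNb : ∀ k x, ‖N k x‖ ≤ 1) (hn : Measurable n) (hb : ∀ x, ‖n x‖ ≤ 1)
    (h : ∀ᵐ x ∂(volume.restrict (Ioo (0 : ℝ) L)), Tendsto (fun k => N k x) atTop (𝓝 (n x)))
    (w : L2 L) :
    Tendsto (fun k => anis γ (N k) (hN k) (hNb k) w) atTop (𝓝 (anis γ n hn hb w)) := by
  rw [tendsto_iff_norm_sub_tendsto_zero]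
  have hsq : ∀ k, ‖anis γ (N k) (hN k) (hNb k) w - anis γ n hn hb w‖ ^ 2 =
      ∫ x in Ioo (0 : ℝ) L,
        (|γ| * ‖inner ℝ (N k x) (w x) • N k x - inner ℝ (n x) (w x) • n x‖) ^ 2 := by
    intro k
    rw [← real_inner_self_eq_norm_sq, L2.inner_def]
    refine integral_congr_ae ?_
    filter_upwards [Lp.coeFn_sub (anis γ (N k) (hN k) (hNb k) w) (anis γ n hn hb w),
      anis_ae (hN k) (hNb k) (γ := γ) w, anis_ae hn hb (γ := γ) w] with x h1 h2 h3
    rw [real_inner_self_eq_norm_sq, h1, Pi.sub_apply, h2, h3, sub_sub_sub_cancel_left, ← smul_sub,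
      norm_smul, norm_sub_rev, Real.norm_eq_abs]
  have hlim : Tendsto (fun k => ∫ x in Ioo (0 : ℝ) L,
      (|γ| * ‖inner ℝ (N k x) (w x) • N k x - inner ℝ (n x) (w x) • n x‖) ^ 2) atTop (𝓝 0) := by
    have h0 : (0 : ℝ) = ∫ _ in Ioo (0 : ℝ) L, (0 : ℝ) := by simp
    refine Eq.subst (motive := fun y => Tendsto _ atTop (𝓝 y)) h0.symm ?_
    refine tendsto_integral_of_dominated_convergence (fun x => (|γ| * (2 * ‖w x‖)) ^ 2) ?_ ?_ ?_ ?_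
    · intro k
      have h1 : AEStronglyMeasurable
          (fun x => inner ℝ (N k x) (w x) • N k x - inner ℝ (n x) (w x) • n x)
          (volume.restrict (Ioo (0 : ℝ) L)) :=
        (aestronglyMeasurable_inner_smul (hN k) w).sub (aestronglyMeasurable_inner_smul hn w)
      exact (h1.norm.const_mul |γ|).pow 2
    · have hw : MemLp w 2 (volume.restrict (Ioo (0 : ℝ) L)) := Lp.memLp w
      have := (hw.norm.integrable_sq).const_mul ((|γ| * 2) ^ 2)
      refine this.congr (Eventually.of_forall fun x => ?_)
      simp only
      ring
    · intro k
      refine Eventually.of_forall fun x => ?_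
      rw [Real.norm_of_nonneg (by positivity)]
      gcongr
      exact norm_inner_smul_sub_le (hNb k x) (hb x) _
    · filter_upwards [h] with x hx
      have h1 : Tendsto (fun k => inner ℝ (N k x) (w x) • N k x) atTop
          (𝓝 (inner ℝ (n x) (w x) • n x)) := (hx.inner tendsto_const_nhds).smul hx
      have h2 := (((h1.sub_const (inner ℝ (n x) (w x) • n x)).norm).const_mul |γ|).pow 2
      simpa using h2
  simp only [← hsq] at hlim
  have := hlim.sqrt
  simpa using this

/-! ### The normal field and the bending energy as a quadratic form -/

theorem measurable_unitNormal {Φ : E3 → ℝ} (hΦ : ContDiff ℝ 1 Φ) : Measurable (unitNormal Φ) := by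
  have h : Continuous (gradient Φ) :=
    (InnerProductSpace.toDual ℝ E3).symm.continuous.comp (hΦ.continuous_fderiv (by simp))
  exact h.measurable.norm.inv.smul h.measurable

theorem norm_unitNormal_le (Φ : E3 → ℝ) (s : E3) : ‖unitNormal Φ s‖ ≤ 1 := by
  rw [unitNormal, norm_smul, norm_inv, norm_norm]
  exact inv_mul_le_one

theorem continuousAt_unitNormal {Φ : E3 → ℝ} (hΦ : ContDiff ℝ 1 Φ) {s : E3}
    (hs : gradient Φ s ≠ 0) : ContinuousAt (unitNormal Φ) s := by
  have h : Continuous (gradient Φ) :=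
    (InnerProductSpace.toDual ℝ E3).symm.continuous.comp (hΦ.continuous_fderiv (by simp))
  exact (h.continuousAt.norm.inv₀ (norm_ne_zero_iff.2 hs)).smul h.continuousAt

theorem measurable_unitNormal_comp {L : ℝ} {Φ : E3 → ℝ} (hΦ : ContDiff ℝ 1 Φ) (f : L2 L) :
    Measurable fun x => unitNormal Φ (f x) :=
  (measurable_unitNormal hΦ).comp (Lp.stronglyMeasurable f).measurable

/-- The multiplication operator with the normal field along the curve `u`. -/
def anisAt {L : ℝ} (γ : ℝ) {Φ : E3 → ℝ} (hΦ : ContDiff ℝ 1 Φ) (u : H2 L) : L2 L →L[ℝ] L2 L :=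
  anis γ (fun x => unitNormal Φ (D 0 u x)) (measurable_unitNormal_comp hΦ _)
    (fun _ => norm_unitNormal_le _ _)

theorem bending_eq {L γ : ℝ} {Φ : E3 → ℝ} (hΦ : ContDiff ℝ 1 Φ) (u : H2 L) :
    bending γ Φ u = (1 / 2) * inner ℝ (D 2 u) (anisAt γ hΦ u (D 2 u)) := by
  rw [anisAt, inner_anis, bending]
  congr 2
  ext1 x
  rw [real_inner_self_eq_norm_sq, sq_abs, sq (inner ℝ _ _)]

theorem le_bending {L γ : ℝ} (hγ : 0 ≤ γ) {Φ : E3 → ℝ} (hΦ : ContDiff ℝ 1 Φ) (u : H2 L) :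
    (1 - γ) / 2 * ‖D 2 u‖ ^ 2 ≤ bending γ Φ u := by
  have h : (1 - γ) * ‖D 2 u‖ ^ 2 ≤ inner ℝ (D 2 u) (anisAt γ hΦ u (D 2 u)) :=
    le_inner_anis _ _ hγ _
  rw [bending_eq hΦ]
  linarith

/-- The normal fields converge along pointwise convergent curves with limit in the surface. -/
theorem tendsto_anisAt {L γ : ℝ} (hL : 0 < L) {Φ : E3 → ℝ} (hΦ : ContDiff ℝ 1 Φ)
    (hreg : ∀ s, Φ s = 0 → gradient Φ s ≠ 0) {u : ℕ → H2 L} {u₀ : H2 L}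
    (hu : ∀ x ∈ Icc 0 L, Tendsto (fun k => rep0 (u k) x) atTop (𝓝 (rep0 u₀ x)))
    (h0 : ∀ᵐ x ∂(volume.restrict (Ioo (0 : ℝ) L)), Φ (D 0 u₀ x) = 0) (w : L2 L) :
    Tendsto (fun k => anisAt γ hΦ (u k) w) atTop (𝓝 (anisAt γ hΦ u₀ w)) := by
  refine tendsto_anis _ _ _ _ ?_ w
  have hall : ∀ᵐ x ∂(volume.restrict (Ioo (0 : ℝ) L)), ∀ k, D 0 (u k) x = rep0 (u k) x :=
    ae_all_iff.2 fun k => D_zero_ae hL (u k)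
  filter_upwards [hall, D_zero_ae hL u₀, h0, ae_restrict_mem measurableSet_Ioo] with x h1 h2 h3 hx
  simp only [h1]
  -- The normal field may jump at critical points of Φ. Continuity is needed only at points of the
  -- limit curve, which lie in the zero set, where the gradient does not vanish.
  refine (continuousAt_unitNormal hΦ (hreg _ h3)).tendsto.comp ?_
  rw [h2]
  exact hu x (Ioo_subset_Icc_self hx)

/-- Evaluation of `u'` at a point, as a continuous linear map. -/
def rep1L {L : ℝ} (x : ℝ) : H2 L →L[ℝ] E3 := slope0 L + (primL x).comp (DL 2)

/-- Evaluation of `u` at a point, as a continuous linear map. -/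
def rep0L {L : ℝ} (x : ℝ) : H2 L →L[ℝ] E3 := value0 L + (primL x).comp (DL 1)

theorem rep0L_apply {L : ℝ} (hL : 0 < L) {x : ℝ} (hx : x ∈ Icc 0 L) (u : H2 L) :
    rep0L x u = rep0 u x := (rep0_eq hL u hx).symm

/-- With w_k = u_k'' and w = u₀'', write A_k w_k = A_k (w_k - w) + A_k w. The first term vanishes
because the operators are uniformly bounded, the second converges by `tendsto_anisAt`. -/
theorem tendsto_bending {L γ : ℝ} (hL : 0 < L) {Φ : E3 → ℝ} (hΦ : ContDiff ℝ 1 Φ)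
    (hreg : ∀ s, Φ s = 0 → gradient Φ s ≠ 0) {u : ℕ → H2 L} {u₀ : H2 L}
    (hu : Tendsto u atTop (𝓝 u₀))
    (h0 : ∀ᵐ x ∂(volume.restrict (Ioo (0 : ℝ) L)), Φ (D 0 u₀ x) = 0) :
    Tendsto (fun k => bending γ Φ (u k)) atTop (𝓝 (bending γ Φ u₀)) := by
  have hp : ∀ x ∈ Icc 0 L, Tendsto (fun k => rep0 (u k) x) atTop (𝓝 (rep0 u₀ x)) := by
    intro x hx
    simpa only [Function.comp_def, rep0L_apply hL hx] using
      ((rep0L x).continuous.tendsto u₀).comp hu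
  have hw : Tendsto (fun k => D 2 (u k)) atTop (𝓝 (D 2 u₀)) :=
    ((DL 2).continuous.tendsto u₀).comp hu
  have h1 := tendsto_anisAt (γ := γ) hL hΦ hreg hp h0 (D 2 u₀)
  have h2 : Tendsto (fun k => anisAt γ hΦ (u k) (D 2 (u k) - D 2 u₀)) atTop (𝓝 0) := by
    refine squeeze_zero_norm (fun k => norm_anis_le _ _ _) ?_
    have := ((hw.sub_const (D 2 u₀)).norm).const_mul (1 + |γ|)
    simpa using this
  have h3 : Tendsto (fun k => anisAt γ hΦ (u k) (D 2 (u k))) atTop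
      (𝓝 (anisAt γ hΦ u₀ (D 2 u₀))) := by
    have := h2.add h1
    simpa using this
  simp only [bending_eq hΦ]
  exact (hw.inner h3).const_mul _

/-! ### From constraints at the nodes to constraints everywhere -/

section Partition
variable {L : ℝ} (P : Partition L)

theorem Partition.le_mesh (j : Fin P.J) : P.z j.succ - P.z j.castSucc ≤ P.mesh :=
  (le_abs_self _).trans (le_ciSup (f := fun j : Fin P.J => |P.z j.succ - P.z j.castSucc|)
    (Set.finite_range _).bddAbove j)

theorem Partition.mem_Icc (j : Fin (P.J + 1)) : P.z j ∈ Icc 0 L :=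
  ⟨P.z_zero.symm.trans_le (P.strictMono.monotone (Fin.zero_le j)),
    (P.strictMono.monotone (Fin.le_last j)).trans_eq P.z_last⟩

theorem Partition.mesh_nonneg : 0 ≤ P.mesh := Real.iSup_nonneg fun _ => abs_nonneg _

theorem Partition.exists_mem_Ico {x : ℝ} (hx : x ∈ Ico 0 L) :
    ∃ j : Fin P.J, x ∈ Ico (P.z j.castSucc) (P.z j.succ) := by
  by_contra! h
  have : ∀ i, P.z i ≤ x := by
    intro i
    induction i using Fin.induction with
    | zero => rw [P.z_zero]; exact hx.1
    | succ j ih => exact not_lt.1 fun h' => h j ⟨ih, h'⟩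
  exact absurd (P.z_last ▸ this (Fin.last _)) (not_le.2 hx.2)

theorem Partition.exists_node_near {x : ℝ} (hx : x ∈ Icc 0 L) :
    ∃ j, |x - P.z j| ≤ P.mesh := by
  rcases hx.2.eq_or_lt with h | h
  · exact ⟨Fin.last _, by rw [P.z_last, h, sub_self, abs_zero]; exact P.mesh_nonneg⟩
  · obtain ⟨j, hj⟩ := P.exists_mem_Ico ⟨hx.1, h⟩
    refine ⟨j.castSucc, ?_⟩
    rw [abs_of_nonneg (by linarith [hj.1])]
    linarith [hj.2, P.le_mesh j]

end Partition

theorem norm_rep1_sub_le {L : ℝ} (u : H2 L) (x y : ℝ) :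
    ‖rep1 u y - rep1 u x‖ ≤ √|y - x| * ‖D 2 u‖ := by
  rw [rep1, rep1, add_sub_add_left_eq_sub]
  exact norm_prim_sub_prim_le _ _ _

theorem norm_rep0_sub_le {L : ℝ} (hL : 0 < L) (u : H2 L) {x y : ℝ} (hx : x ∈ Icc 0 L)
    (hy : y ∈ Icc 0 L) : ‖rep0 u y - rep0 u x‖ ≤ √|y - x| * ‖D 1 u‖ := by
  rw [rep0_eq hL u hx, rep0_eq hL u hy, add_sub_add_left_eq_sub]
  exact norm_prim_sub_prim_le _ _ _

theorem WeakTendsto.tendsto_apply {L : ℝ} {u : ℕ → H2 L} {u₀ : H2 L} (h : WeakTendsto u u₀)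
    {m : ℕ} (T : H2 L →L[ℝ] EuclideanSpace ℝ (Fin m)) :
    Tendsto (fun k => T (u k)) atTop (𝓝 (T u₀)) := by
  have h1 : Tendsto (fun k => EuclideanSpace.equiv (Fin m) ℝ (T (u k))) atTop
      (𝓝 (EuclideanSpace.equiv (Fin m) ℝ (T u₀))) :=
    tendsto_pi_nhds.2 fun i => h ((EuclideanSpace.proj i : _ →L[ℝ] ℝ).comp T)
  simpa [Function.comp_def] using
    ((EuclideanSpace.equiv (Fin m) ℝ).symm.continuous.tendsto _).comp h1

theorem WeakTendsto.comp {L : ℝ} {u : ℕ → H2 L} {u₀ : H2 L} (h : WeakTendsto u u₀)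
    {φ : ℕ → ℕ} (hφ : Tendsto φ atTop atTop) : WeakTendsto (fun k => u (φ k)) u₀ :=
  fun F => (h F).comp hφ

theorem WeakTendsto.tendsto_rep1 {L : ℝ} {u : ℕ → H2 L} {u₀ : H2 L} (h : WeakTendsto u u₀)
    (x : ℝ) : Tendsto (fun k => rep1 (u k) x) atTop (𝓝 (rep1 u₀ x)) :=
  h.tendsto_apply (rep1L x)

theorem WeakTendsto.tendsto_rep0 {L : ℝ} (hL : 0 < L) {u : ℕ → H2 L} {u₀ : H2 L}
    (h : WeakTendsto u u₀) {x : ℝ} (hx : x ∈ Icc 0 L) :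
    Tendsto (fun k => rep0 (u k) x) atTop (𝓝 (rep0 u₀ x)) := by
  simpa only [rep0L_apply hL hx] using h.tendsto_apply (rep0L x)

/-- The C¹ representative is unique on [0,L], so the nodal constraints can be read off from `rep0`
and `rep1`. -/
theorem mem_discreteAdmissible_iff {L : ℝ} (hL : 0 < L) {P : Partition L} {Φ : E3 → ℝ} {l : ℕ}
    {B : H2 L →L[ℝ] EuclideanSpace ℝ (Fin l)} {b : EuclideanSpace ℝ (Fin l)} {u : H2 L} :
    u ∈ discreteAdmissible P Φ B b ↔ (∃ v ∈ cubicSpace P, IsC1Rep u v) ∧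
      (∀ j, ‖rep1 u (P.z j)‖ ^ 2 = 1 ∧ Φ (rep0 u (P.z j)) = 0) ∧ B u = b := by
  constructor
  · rintro ⟨⟨v, hv, hr, hn⟩, hB⟩
    refine ⟨⟨v, hv, hr⟩, fun j => ?_, hB⟩
    rw [← hr.derivWithin_eq hL (P.mem_Icc j), ← hr.eqOn hL (P.mem_Icc j)]
    exact hn j
  · rintro ⟨⟨v, hv, hr⟩, hn, hB⟩
    refine ⟨⟨v, hv, hr, fun j => ?_⟩, hB⟩
    rw [hr.derivWithin_eq hL (P.mem_Icc j), hr.eqOn hL (P.mem_Icc j)]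
    exact hn j

theorem mem_admissible_iff {L : ℝ} (hL : 0 < L) {Φ : E3 → ℝ} (hΦ : Continuous Φ) {l : ℕ}
    {B : H2 L →L[ℝ] EuclideanSpace ℝ (Fin l)} {b : EuclideanSpace ℝ (Fin l)} {u : H2 L} :
    u ∈ admissible Φ B b ↔ (∀ x ∈ Icc 0 L, ‖rep1 u x‖ ^ 2 = 1) ∧
      (∀ x ∈ Icc 0 L, Φ (rep0 u x) = 0) ∧ B u = b := by
  have hIcc : ∀ f : ℝ → ℝ, Continuous f → ∀ c : ℝ,
      ((∀ᵐ x ∂(volume.restrict (Ioo (0 : ℝ) L)), f x = c) ↔ ∀ x ∈ Icc 0 L, f x = c) := by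
    intro f hf c
    constructor
    · intro h
      exact Measure.eqOn_of_ae_eq (μ := volume) (f := f) (g := fun _ => c)
        (by rwa [← Measure.restrict_congr_set (Ioo_ae_eq_Icc (μ := volume))])
        hf.continuousOn continuousOn_const (by rw [interior_Icc, closure_Ioo hL.ne])
    · intro h
      filter_upwards [ae_restrict_mem measurableSet_Ioo] with x hx
      exact h x (Ioo_subset_Icc_self hx)
  rw [← hIcc (fun x => ‖rep1 u x‖ ^ 2) ((continuous_rep1 u).norm.pow 2),
    ← hIcc (fun x => Φ (rep0 u x)) (hΦ.comp (continuous_rep0 u))]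
  have e1 : (∀ᵐ x ∂(volume.restrict (Ioo (0 : ℝ) L)), ‖D 1 u x‖ ^ 2 = 1) ↔
      ∀ᵐ x ∂(volume.restrict (Ioo (0 : ℝ) L)), ‖rep1 u x‖ ^ 2 = 1 :=
    eventually_congr ((D_one_ae hL u).mono fun x hx => by rw [hx])
  have e2 : (∀ᵐ x ∂(volume.restrict (Ioo (0 : ℝ) L)), Φ (D 0 u x) = 0) ↔
      ∀ᵐ x ∂(volume.restrict (Ioo (0 : ℝ) L)), Φ (rep0 u x) = 0 :=
    eventually_congr ((D_zero_ae hL u).mono fun x hx => by rw [hx])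
  exact and_congr e1 (and_congr_left' e2)

/-- The uniform Hölder bound lets the evaluation point move with k, here to a node near x. -/
theorem tendsto_sub_of_mesh {u : ℕ → ℝ → E3} {M : ℝ} {h : ℕ → ℝ} {x : ℝ} {y : ℕ → ℝ}
    (hh : Tendsto h atTop (𝓝 0)) (hxy : ∀ k, |x - y k| ≤ h k)
    (hu : ∀ k, ‖u k x - u k (y k)‖ ≤ √|x - y k| * M) (hM : 0 ≤ M) {p : E3}
    (hp : Tendsto (fun k => u k x) atTop (𝓝 p)) : Tendsto (fun k => u k (y k)) atTop (𝓝 p) := by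
  have h1 : Tendsto (fun k => u k x - u k (y k)) atTop (𝓝 0) := by
    refine squeeze_zero_norm (a := fun k => √(h k) * M) (fun k => (hu k).trans ?_) ?_
    · gcongr
      exact hxy k
    · simpa using hh.sqrt.mul_const M
  simpa using hp.sub h1

/-- Weak limits of discrete admissible curves of bounded curvature are admissible. -/
theorem WeakTendsto.mem_admissible {L : ℝ} (hL : 0 < L) {Φ : E3 → ℝ} (hΦ : Continuous Φ) {l : ℕ}
    {B : H2 L →L[ℝ] EuclideanSpace ℝ (Fin l)} {b : EuclideanSpace ℝ (Fin l)}
    {P : ℕ → Partition L} (hP : Tendsto (fun k => (P k).mesh) atTop (𝓝 0))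
    {u : ℕ → H2 L} {u₀ : H2 L} (h : WeakTendsto u u₀)
    (hu : ∀ k, u k ∈ discreteAdmissible (P k) Φ B b) {M : ℝ} (hM : ∀ k, ‖D 2 (u k)‖ ≤ M) :
    u₀ ∈ admissible Φ B b := by
  have hM0 : 0 ≤ M := (norm_nonneg _).trans (hM 0)
  have hd := fun k => ((mem_discreteAdmissible_iff hL).1 (hu k)).2
  obtain ⟨C, hC⟩ : ∃ C, ∀ k, ‖slope0 L (u k)‖ ≤ C := by
    obtain ⟨C, hC⟩ := (h.tendsto_apply (slope0 L)).norm.bddAbove_range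
    exact ⟨C, fun k => hC ⟨k, rfl⟩⟩
  have hC0 : 0 ≤ C := (norm_nonneg _).trans (hC 0)
  have hM1 : ∀ k, ‖D 1 (u k)‖ ≤ ‖volterra L‖ * M + ‖constL L‖ * C := by
    intro k
    rw [D_one_eq hL]
    refine (norm_add_le _ _).trans (add_le_add ?_ ?_)
    · exact (volterra L).le_opNorm_of_le (hM k)
    · exact (constL L).le_opNorm_of_le (hC k)
  refine (mem_admissible_iff hL hΦ).2 ⟨fun x hx => ?_, fun x hx => ?_, ?_⟩
  · choose j hj using fun k => (P k).exists_node_near hx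
    have h1 : Tendsto (fun k => rep1 (u k) ((P k).z (j k))) atTop (𝓝 (rep1 u₀ x)) :=
      tendsto_sub_of_mesh (u := fun k => rep1 (u k)) (M := M) hP hj
        (fun k => (norm_rep1_sub_le _ _ _).trans (by gcongr; exact hM k)) hM0 (h.tendsto_rep1 x)
    have h2 := h1.norm.pow 2
    simp only [fun k => ((hd k).1 (j k)).1] at h2
    exact tendsto_nhds_unique h2 tendsto_const_nhds
  · choose j hj using fun k => (P k).exists_node_near hx
    have h1 : Tendsto (fun k => rep0 (u k) ((P k).z (j k))) atTop (𝓝 (rep0 u₀ x)) :=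
      tendsto_sub_of_mesh (u := fun k => rep0 (u k)) (M := ‖volterra L‖ * M + ‖constL L‖ * C) hP hj
        (fun k => (norm_rep0_sub_le hL _ ((P k).mem_Icc _) hx).trans (by gcongr; exact hM1 k))
        (by positivity) (h.tendsto_rep0 hL hx)
    have h2 := (hΦ.tendsto _).comp h1
    simp only [Function.comp_def, fun k => ((hd k).1 (j k)).2] at h2
    exact tendsto_nhds_unique h2 tendsto_const_nhds
  · have h1 := h.tendsto_apply B
    simp only [fun k => (hd k).2] at h1
    exact tendsto_nhds_unique h1 tendsto_const_nhds

/-! ### Weak lower semicontinuity -/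

/-- Weak lower semicontinuity of the bending energy, as a convergent sequence of lower bounds. -/
theorem WeakTendsto.exists_le_bending {L γ : ℝ} (hL : 0 < L) (hγ0 : 0 ≤ γ) (hγ1 : γ < 1)
    {Φ : E3 → ℝ} (hΦ : ContDiff ℝ 1 Φ) (hreg : ∀ s, Φ s = 0 → gradient Φ s ≠ 0)
    {u : ℕ → H2 L} {u₀ : H2 L} (h : WeakTendsto u u₀)
    (h0 : ∀ᵐ x ∂(volume.restrict (Ioo (0 : ℝ) L)), Φ (D 0 u₀ x) = 0)
    {M : ℝ} (hM : ∀ k, ‖D 2 (u k)‖ ≤ M) :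
    ∃ r : ℕ → ℝ, (∀ k, r k ≤ bending γ Φ (u k)) ∧ Tendsto r atTop (𝓝 (bending γ Φ u₀)) := by
  set w := D 2 u₀
  -- This is the tangent to the convex function v ↦ ½⟨v, A_k v⟩ at w, evaluated at u_k''. It is a
  -- lower bound because ⟨u_k'' - w, A_k (u_k'' - w)⟩ ≥ 0, and it is affine in the weakly convergent
  -- u_k''.
  refine ⟨fun k => inner ℝ (D 2 (u k)) (anisAt γ hΦ (u k) w) -
    (1 / 2) * inner ℝ w (anisAt γ hΦ (u k) w), fun k => ?_, ?_⟩
  · have h1 : 0 ≤ inner ℝ (D 2 (u k) - w) (anisAt γ hΦ (u k) (D 2 (u k) - w)) :=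
      le_trans (mul_nonneg (by linarith) (sq_nonneg _)) (le_inner_anis _ _ hγ0 _)
    have h2 : inner ℝ w (anisAt γ hΦ (u k) (D 2 (u k))) =
        inner ℝ (D 2 (u k)) (anisAt γ hΦ (u k) w) := inner_anis_comm _ _ _ _
    rw [map_sub, inner_sub_left, inner_sub_right, inner_sub_right, h2] at h1
    rw [bending_eq hΦ]
    linarith
  · have hS : Tendsto (fun k => anisAt γ hΦ (u k) w) atTop (𝓝 (anisAt γ hΦ u₀ w)) :=
      tendsto_anisAt hL hΦ hreg (fun x hx => h.tendsto_rep0 hL hx) h0 w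
    have h1 : Tendsto (fun k => inner ℝ w (anisAt γ hΦ (u k) w)) atTop
        (𝓝 (inner ℝ w (anisAt γ hΦ u₀ w))) := tendsto_const_nhds.inner hS
    have h2 : Tendsto (fun k => inner ℝ (D 2 (u k)) (anisAt γ hΦ u₀ w)) atTop
        (𝓝 (inner ℝ w (anisAt γ hΦ u₀ w))) := by
      have := h ((innerSL ℝ (anisAt γ hΦ u₀ w)).comp (DL 2))
      simpa only [ContinuousLinearMap.comp_apply, innerSL_apply_apply, DL_apply,
        real_inner_comm (anisAt γ hΦ u₀ w)] using this
    have h3 : Tendsto (fun k => inner ℝ (D 2 (u k)) (anisAt γ hΦ (u k) w - anisAt γ hΦ u₀ w)) atTop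
        (𝓝 0) := by
      refine squeeze_zero_norm (a := fun k => M * ‖anisAt γ hΦ (u k) w - anisAt γ hΦ u₀ w‖)
        (fun k => (norm_inner_le_norm _ _).trans (by gcongr; exact hM k)) ?_
      simpa using ((tendsto_iff_norm_sub_tendsto_zero.1 hS).const_mul M)
    have h4 := (h2.add h3).sub (h1.const_mul (1 / 2))
    rw [bending_eq hΦ]
    refine (h4.congr fun k => ?_).trans (le_of_eq (congrArg 𝓝 ?_))
    · rw [← inner_add_right, add_sub_cancel]
    · ring

/-! ### Weak compactness and control of the initial value -/

/-- Bounded sequences in `L²` have weakly convergent subsequences. -/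
theorem exists_weak_subseq_L2 {L : ℝ} (w : ℕ → L2 L) {M : ℝ} (hM : ∀ k, ‖w k‖ ≤ M) :
    ∃ w₀ : L2 L, ∃ φ : ℕ → ℕ, StrictMono φ ∧
      ∀ F : L2 L →L[ℝ] ℝ, Tendsto (fun k => F (w (φ k))) atTop (𝓝 (F w₀)) := by
  -- A finite exponent makes L² separable, as sequential compactness in the weak-* topology
  -- requires.
  have : Fact ((2 : ENNReal) ≠ ⊤) := ⟨by simp⟩
  obtain ⟨ξ, -, φ, hφ, hlim⟩ := WeakDual.isSeqCompact_closedBall ℝ (L2 L) 0 M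
    (x := fun k => StrongDual.toWeakDual (InnerProductSpace.toDual ℝ (L2 L) (w k)))
    (fun k => by simpa using hM k)
  refine ⟨(InnerProductSpace.toDual ℝ (L2 L)).symm (WeakDual.toStrongDual ξ), φ, hφ, fun F => ?_⟩
  have h1 := ((WeakDual.eval_continuous
    ((InnerProductSpace.toDual ℝ (L2 L)).symm F)).tendsto ξ).comp hlim
  have h2 : ∀ v : L2 L, F v = inner ℝ v ((InnerProductSpace.toDual ℝ (L2 L)).symm F) := fun v => by
    rw [real_inner_comm, InnerProductSpace.toDual_symm_apply]
  rw [h2, InnerProductSpace.toDual_symm_apply]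
  refine h1.congr fun k => ?_
  rw [h2]
  rfl

/-- Sequential weak compactness of bounded sets of curves. -/
theorem exists_weakTendsto_subseq {L : ℝ} (hL : 0 < L) (u : ℕ → H2 L) {A C M : ℝ}
    (hA : ∀ k, ‖value0 L (u k)‖ ≤ A) (hC : ∀ k, ‖slope0 L (u k)‖ ≤ C) (hM : ∀ k, ‖D 2 (u k)‖ ≤ M) :
    ∃ u₀ : H2 L, ∃ φ : ℕ → ℕ, StrictMono φ ∧ WeakTendsto (fun k => u (φ k)) u₀ := by
  obtain ⟨a, -, φ₁, hφ₁, ha⟩ := tendsto_subseq_of_bounded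
    (Metric.isBounded_closedBall (x := (0 : E3)) (r := A))
    (x := fun k => value0 L (u k)) (fun k => by simpa using hA k)
  obtain ⟨c, -, φ₂, hφ₂, hc⟩ := tendsto_subseq_of_bounded
    (Metric.isBounded_closedBall (x := (0 : E3)) (r := C))
    (x := fun k => slope0 L (u (φ₁ k))) (fun k => by simpa using hC _)
  obtain ⟨w, φ₃, hφ₃, hw⟩ := exists_weak_subseq_L2 (fun k => D 2 (u (φ₁ (φ₂ k)))) fun k => hM _
  refine ⟨build hL (a, c, w), fun k => φ₁ (φ₂ (φ₃ k)), hφ₁.comp (hφ₂.comp hφ₃), fun F => ?_⟩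
  have hsplit : ∀ (a c : E3) (w : L2 L), F (build hL (a, c, w)) =
      F (build hL (a, 0, 0)) + F (build hL (0, c, 0)) + F (build hL (0, 0, w)) := by
    intro a c w
    rw [← map_add, ← map_add, ← map_add, ← map_add]
    simp
  have e1 : Tendsto (fun k => F (build hL (value0 L (u (φ₁ (φ₂ (φ₃ k)))), 0, 0))) atTop
      (𝓝 (F (build hL (a, 0, 0)))) :=
    ((F.comp ((build hL).comp (ContinuousLinearMap.inl ℝ E3 (E3 × L2 L)))).continuous.tendsto
      a).comp (ha.comp (hφ₂.comp hφ₃).tendsto_atTop)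
  have e2 : Tendsto (fun k => F (build hL (0, slope0 L (u (φ₁ (φ₂ (φ₃ k)))), 0))) atTop
      (𝓝 (F (build hL (0, c, 0)))) :=
    ((F.comp ((build hL).comp ((ContinuousLinearMap.inr ℝ E3 (E3 × L2 L)).comp
      (ContinuousLinearMap.inl ℝ E3 (L2 L))))).continuous.tendsto c).comp
      (hc.comp hφ₃.tendsto_atTop)
  have e3 : Tendsto (fun k => F (build hL (0, 0, D 2 (u (φ₁ (φ₂ (φ₃ k))))))) atTop
      (𝓝 (F (build hL (0, 0, w)))) :=
    hw (F.comp ((build hL).comp ((ContinuousLinearMap.inr ℝ E3 (E3 × L2 L)).comp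
      (ContinuousLinearMap.inr ℝ E3 (L2 L)))))
  rw [hsplit a c w]
  refine ((e1.add e2).add e3).congr fun k => ?_
  rw [← hsplit, build_eta]

/-- The initial value is controlled by `B u`, the initial slope and the second derivative. -/
theorem exists_norm_value0_le {L : ℝ} (hL : 0 < L) {l : ℕ}
    {B : H2 L →L[ℝ] EuclideanSpace ℝ (Fin l)} (hdef : Definiteness B) :
    ∃ K : ℝ, 0 ≤ K ∧ ∀ u : H2 L, ‖value0 L u‖ ≤ K * (‖B u‖ + ‖slope0 L u‖ + ‖D 2 u‖) := by
  let T : E3 →L[ℝ] EuclideanSpace ℝ (Fin l) :=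
    B.comp ((build hL).comp (ContinuousLinearMap.inl ℝ E3 (E3 × L2 L)))
  let R : (E3 × L2 L) →L[ℝ] EuclideanSpace ℝ (Fin l) :=
    B.comp ((build hL).comp (ContinuousLinearMap.inr ℝ E3 (E3 × L2 L)))
  -- `T` is `B` on constant curves. Their second derivative is zero, so definiteness makes `T`
  -- injective, and finite dimension turns this into a lower bound.
  have hker : LinearMap.ker (T : E3 →ₗ[ℝ] EuclideanSpace ℝ (Fin l)) = ⊥ := by
    refine LinearMap.ker_eq_bot'.2 fun a ha => ?_
    have h0 : build hL (a, 0, 0) = 0 := hdef _ ha (by rw [D_two_build, norm_zero])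
    rw [← value0_build hL a 0 0, h0, map_zero]
  obtain ⟨K, -, hK⟩ := (T : E3 →ₗ[ℝ] EuclideanSpace ℝ (Fin l)).exists_antilipschitzWith hker
  refine ⟨K * (1 + ‖R‖), by positivity, fun u => ?_⟩
  have h1 : ‖value0 L u‖ ≤ K * ‖T (value0 L u)‖ := by
    simpa using hK.le_mul_dist (value0 L u) 0
  have h2 : T (value0 L u) = B u - R (slope0 L u, D 2 u) := by
    rw [eq_sub_iff_add_eq]
    conv_rhs => rw [← build_eta hL u]
    change B (build hL (value0 L u, 0)) + B (build hL (0, (slope0 L u, D 2 u))) = _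
    rw [← map_add, ← map_add]
    simp
  have h3 : ‖(slope0 L u, D 2 u)‖ ≤ ‖slope0 L u‖ + ‖D 2 u‖ :=
    max_le (le_add_of_nonneg_right (norm_nonneg _)) (le_add_of_nonneg_left (norm_nonneg _))
  calc ‖value0 L u‖ ≤ K * ‖T (value0 L u)‖ := h1
    _ ≤ K * (‖B u‖ + ‖R‖ * (‖slope0 L u‖ + ‖D 2 u‖)) := by
        rw [h2]
        gcongr
        exact (norm_sub_le _ _).trans (add_le_add_right (R.le_opNorm_of_le h3) _)
    _ ≤ K * ((1 + ‖R‖) * (‖B u‖ + ‖slope0 L u‖ + ‖D 2 u‖)) := by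
        gcongr
        nlinarith [norm_nonneg (B u), norm_nonneg R, norm_nonneg (slope0 L u), norm_nonneg (D 2 u),
          mul_nonneg (norm_nonneg R) (norm_nonneg (B u))]
    _ = K * (1 + ‖R‖) * (‖B u‖ + ‖slope0 L u‖ + ‖D 2 u‖) := by ring

/-! ### Piecewise affine functions and their L² projection -/

section Piecewise
variable {L : ℝ} (P : Partition L)

/-- The piecewise affine function with the coefficients `p`. -/
def pieceFun (p : Fin P.J → E3 × E3) (x : ℝ) : E3 :=
  ∑ j, (Ico (P.z j.castSucc) (P.z j.succ)).indicator (fun x => (p j).1 + x • (p j).2) x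

/-- The half-open cells are disjoint, so a single summand survives. -/
theorem pieceFun_of_mem (p : Fin P.J → E3 × E3) {j : Fin P.J} {x : ℝ}
    (hx : x ∈ Ico (P.z j.castSucc) (P.z j.succ)) : pieceFun P p x = (p j).1 + x • (p j).2 := by
  rw [pieceFun, Finset.sum_eq_single j, indicator_of_mem hx]
  · intro i _ hij
    refine indicator_of_notMem (fun hi => ?_) _
    rcases lt_or_gt_of_ne hij with h | h
    · have : P.z i.succ ≤ P.z j.castSucc := P.strictMono.monotone (by
        rw [Fin.le_def]; exact h)
      exact absurd (hi.2.trans_le this) (not_lt.2 hx.1)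
    · have : P.z j.succ ≤ P.z i.castSucc := P.strictMono.monotone (by
        rw [Fin.le_def]; exact h)
      exact absurd (hx.2.trans_le this) (not_lt.2 hi.1)
  · simp

theorem memLp_pieceFun (p : Fin P.J → E3 × E3) :
    MemLp (pieceFun P p) 2 (volume.restrict (Ioo (0 : ℝ) L)) :=
  memLp_finsetSum _ fun j _ => (memLp_of_continuous (by fun_prop)).indicator measurableSet_Ico

/-- The embedding of piecewise affine functions into `L²(0,L)`. -/
def pieceL : (Fin P.J → E3 × E3) →ₗ[ℝ] L2 L where
  toFun p := (memLp_pieceFun P p).toLp _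
  map_add' p q := by
    rw [← MemLp.toLp_add]
    congr 1
    ext1 x
    rw [Pi.add_apply, pieceFun, pieceFun, pieceFun, ← Finset.sum_add_distrib]
    refine Finset.sum_congr rfl fun j _ => ?_
    simp only [indicator, Pi.add_apply, Prod.fst_add, Prod.snd_add, smul_add]
    split_ifs
    · abel
    · rw [add_zero]
  map_smul' c p := by
    rw [RingHom.id_apply, ← MemLp.toLp_const_smul]
    congr 1
    ext1 x
    rw [Pi.smul_apply, pieceFun, pieceFun, Finset.smul_sum]
    refine Finset.sum_congr rfl fun j _ => ?_
    simp only [indicator, Pi.smul_apply, Prod.smul_fst, Prod.smul_snd]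
    split_ifs
    · rw [smul_add, smul_comm x c]
    · rw [smul_zero]

theorem pieceL_ae (p : Fin P.J → E3 × E3) :
    pieceL P p =ᵐ[volume.restrict (Ioo (0 : ℝ) L)] pieceFun P p :=
  MemLp.coeFn_toLp (memLp_pieceFun P p)

/-- A function orthogonal to the piecewise affine functions has vanishing moments up to nodes. -/
theorem integral_smul_ext_eq_zero {e : L2 L}
    (he : ∀ p, inner ℝ e (pieceL P p) = 0) (i : Fin (P.J + 1)) (α β : ℝ) :
    ∫ x in (0 : ℝ)..P.z i, (α + x * β) • ext e x = 0 := by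
  have hz := P.mem_Icc i
  have hint : Integrable (fun x => (α + x * β) • e x) (volume.restrict (Ioo 0 (P.z i))) := by
    have h1 : MemLp (fun x : ℝ => α + x * β) 2 (volume.restrict (Ioo 0 (P.z i))) := by
      have hc : Continuous fun x : ℝ => α + x * β := by fun_prop
      obtain ⟨C, hC⟩ := isCompact_Icc.exists_bound_of_continuousOn
        (hc.continuousOn (s := Icc 0 (P.z i)))
      refine MemLp.of_bound hc.aestronglyMeasurable C ?_
      filter_upwards [ae_restrict_mem measurableSet_Ioo] with x hx
      exact hC x (Ioo_subset_Icc_self hx)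
    have h2 : MemLp e 2 (volume.restrict (Ioo 0 (P.z i))) :=
      (Lp.memLp e).mono_measure (Measure.restrict_mono (Ioo_subset_Ioo_right hz.2) le_rfl)
    exact memLp_one_iff_integrable.1 (h2.smul h1)
  have h0 : ∫ x in Ioo 0 (P.z i), (α + x * β) • e x = 0 := by
    refine ext_inner_left ℝ fun v => ?_
    rw [inner_zero_right, ← integral_inner hint]
    -- The test function is (α + xβ) v on the cells to the left of z_i and zero on the others; it is
    -- admissible because no continuity is imposed at the nodes.
    refine Eq.trans ?_ (he fun j => if j.castSucc < i then (α • v, β • v) else 0)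
    rw [L2.inner_def]
    have hset : Ioo 0 (P.z i) = Ioo 0 L ∩ Iio (P.z i) := by
      ext x
      simp only [mem_Ioo, mem_inter_iff, mem_Iio]
      exact ⟨fun h => ⟨⟨h.1, h.2.trans_le hz.2⟩, h.2⟩, fun h => ⟨h.1.1, h.2⟩⟩
    rw [hset, ← setIntegral_indicator measurableSet_Iio]
    refine integral_congr_ae ?_
    filter_upwards [pieceL_ae P (fun j => if j.castSucc < i then (α • v, β • v) else 0),
      ae_restrict_mem measurableSet_Ioo] with x hx hxm
    obtain ⟨j, hj⟩ := P.exists_mem_Ico (Ioo_subset_Ico_self hxm)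
    rw [hx, pieceFun_of_mem P _ hj]
    by_cases h : j.castSucc < i
    · have hxi : x ∈ Iio (P.z i) := hj.2.trans_le (P.strictMono.monotone (by
        rw [Fin.le_def]; exact h))
      rw [indicator_of_mem hxi, if_pos h, smul_smul, ← add_smul, inner_smul_right,
        inner_smul_right, real_inner_comm]
    · have hxi : x ∉ Iio (P.z i) := fun h' =>
        absurd (hj.1.trans_lt h') (not_lt.2 (P.strictMono.monotone (not_lt.1 h)))
      rw [indicator_of_notMem hxi, if_neg h]
      simp
  rw [intervalIntegral.integral_of_le hz.1, integral_Ioc_eq_integral_Ioo, ← h0]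
  refine setIntegral_congr_fun measurableSet_Ioo fun x hx => ?_
  simp only [ext_of_mem e (Ioo_subset_Ioo_right hz.2 hx)]

theorem prim_node_eq_zero {e : L2 L} (he : ∀ p, inner ℝ e (pieceL P p) = 0) (i : Fin (P.J + 1)) :
    prim e (P.z i) = 0 := by
  simpa [prim] using integral_smul_ext_eq_zero P he i 1 0

/-- Integration by parts against x: the boundary term is a multiple of the zeroth moment of e, the
remaining term is its first moment, and both vanish. -/
theorem integral_prim_node_eq_zero {e : L2 L} (he : ∀ p, inner ℝ e (pieceL P p) = 0)
    (i : Fin (P.J + 1)) : ∫ x in (0 : ℝ)..P.z i, prim e x = 0 := by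
  have h := integral_deriv_smul_primitive (intervalIntegrable_ext e 0 (P.z i))
    (ψ := fun x => x) contDiff_id
  have h1 : ∫ x in (0 : ℝ)..P.z i, x • ext e x = 0 := by
    simpa using integral_smul_ext_eq_zero P he i 0 1
  have h2 : ∫ t in (0 : ℝ)..P.z i, ext e t = 0 := prim_node_eq_zero P he i
  rw [h1, h2] at h
  simpa [prim] using h

/-- The `L²` projection onto piecewise affine functions. -/
def projPiece (w : L2 L) : L2 L := (LinearMap.range (pieceL P)).starProjection w

theorem exists_pieceL_eq_projPiece (w : L2 L) : ∃ p, pieceL P p = projPiece P w :=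
  LinearMap.mem_range.1 (Submodule.starProjection_apply_mem (LinearMap.range (pieceL P)) w)

theorem inner_projPiece_sub (w : L2 L) (p : Fin P.J → E3 × E3) :
    inner ℝ (projPiece P w - w) (pieceL P p) = 0 := by
  rw [← neg_sub, inner_neg_left, neg_eq_zero]
  exact Submodule.starProjection_inner_eq_zero w _ ⟨p, rfl⟩

/-- Best approximation, by the theorem of Pythagoras. -/
theorem norm_projPiece_sub_le (w : L2 L) (p : Fin P.J → E3 × E3) :
    ‖projPiece P w - w‖ ≤ ‖pieceL P p - w‖ := by
  obtain ⟨q, hq⟩ := exists_pieceL_eq_projPiece P w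
  have h1 : inner ℝ (projPiece P w - w) (pieceL P p - projPiece P w) = 0 := by
    rw [← hq, ← map_sub, hq]
    exact inner_projPiece_sub P w _
  have h2 : pieceL P p - w = (projPiece P w - w) + (pieceL P p - projPiece P w) := by abel
  have h3 := norm_add_sq_eq_norm_sq_add_norm_sq_real h1
  rw [← h2] at h3
  nlinarith [norm_nonneg (projPiece P w - w), norm_nonneg (pieceL P p - w),
    mul_self_nonneg ‖pieceL P p - projPiece P w‖]

end Piecewise

/-- Piecewise constant functions approximate in `L²` as the mesh size tends to zero. -/
theorem exists_pieceL_near {L : ℝ} (w : L2 L) {ε : ℝ} (hε : 0 < ε) :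
    ∃ δ > 0, ∀ P : Partition L, P.mesh < δ → ∃ p, ‖pieceL P p - w‖ ≤ ε := by
  -- Half of ε pays for a continuous compactly supported approximation g, the other half for
  -- sampling g at left end points, by uniform continuity.
  obtain ⟨g, hgs, hg, hgc, -⟩ := (memLp_ext w).exists_hasCompactSupport_eLpNorm_sub_le
    (by simp) (ε := ENNReal.ofReal (ε / 2)) (by simpa using hε)
  have hguc := hgs.uniformContinuous_of_continuous hgc
  -- C is the L² norm of the constant 1 on (0,L); dividing by C + 1 below avoids a separate case C =
  -- 0.
  set C : ℝ := (measureUnivNNReal (volume.restrict (Ioo (0 : ℝ) L)) : ℝ) ^ (2 : ENNReal).toReal⁻¹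
  have hC : 0 ≤ C := by positivity
  obtain ⟨δ, hδ, hgδ⟩ := Metric.uniformContinuous_iff.1 hguc (ε / (2 * (C + 1))) (by positivity)
  refine ⟨δ, hδ, fun P hP => ⟨fun j => (g (P.z j.castSucc), 0), ?_⟩⟩
  set G : L2 L := (memLp_of_continuous hgc).toLp g
  have hG : G =ᵐ[volume.restrict (Ioo (0 : ℝ) L)] g := MemLp.coeFn_toLp _
  have h1 : ‖w - G‖ ≤ ε / 2 := by
    rw [Lp.norm_def]
    refine ENNReal.toReal_le_of_le_ofReal (by positivity) (le_trans ?_ hg)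
    refine le_trans (le_of_eq (eLpNorm_congr_ae ?_))
      (eLpNorm_mono_measure _ (Measure.restrict_le_self (s := Ioo (0 : ℝ) L)))
    filter_upwards [Lp.coeFn_sub w G, hG, ae_restrict_mem measurableSet_Ioo] with x h1 h2 h3
    rw [h1, Pi.sub_apply, Pi.sub_apply, h2, ext_of_mem w h3]
  have h2 : ‖pieceL P (fun j => (g (P.z j.castSucc), 0)) - G‖ ≤ C * (ε / (2 * (C + 1))) := by
    refine Lp.norm_le_of_ae_bound (by positivity) ?_
    filter_upwards [Lp.coeFn_sub (pieceL P (fun j => (g (P.z j.castSucc), 0))) G, hG,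
      pieceL_ae P (fun j => (g (P.z j.castSucc), 0)), ae_restrict_mem measurableSet_Ioo]
      with x h1 h2 h3 hx
    obtain ⟨j, hj⟩ := P.exists_mem_Ico (Ioo_subset_Ico_self hx)
    rw [h1, Pi.sub_apply, h2, h3, pieceFun_of_mem P _ hj, smul_zero, add_zero, ← dist_eq_norm]
    refine (hgδ ?_).le
    rw [Real.dist_eq, abs_sub_comm, abs_of_nonneg (by linarith [hj.1])]
    linarith [hj.2, P.le_mesh j]
  have h3 : C * (ε / (2 * (C + 1))) ≤ ε / 2 := by
    rw [mul_div_assoc', div_le_div_iff₀ (by positivity) (by positivity)]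
    nlinarith
  calc ‖pieceL P (fun j => (g (P.z j.castSucc), 0)) - w‖
      ≤ ‖pieceL P (fun j => (g (P.z j.castSucc), 0)) - G‖ + ‖G - w‖ :=
        norm_sub_le_norm_sub_add_norm_sub _ _ _
    _ ≤ ε / 2 + ε / 2 := by
        rw [norm_sub_rev G w]
        exact add_le_add (h2.trans h3) h1
    _ = ε := by ring

theorem tendsto_projPiece {L : ℝ} {P : ℕ → Partition L}
    (hP : Tendsto (fun k => (P k).mesh) atTop (𝓝 0)) (w : L2 L) :
    Tendsto (fun k => projPiece (P k) w) atTop (𝓝 w) := by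
  rw [Metric.tendsto_atTop']
  intro ε hε
  obtain ⟨δ, hδ, h⟩ := exists_pieceL_near w (half_pos hε)
  obtain ⟨N, hN⟩ := eventually_atTop.1 (hP.eventually_lt_const hδ)
  refine ⟨N, fun k hk => ?_⟩
  obtain ⟨p, hp⟩ := h (P k) (hN k hk.le)
  rw [dist_eq_norm]
  linarith [norm_projPiece_sub_le (P k) w p]

/-! ### Hermite interpolation -/

/-- The cubic Hermite interpolant of a curve. -/
def hermite {L : ℝ} (hL : 0 < L) (P : Partition L) (u : H2 L) : H2 L :=
  build hL (value0 L u, slope0 L u, projPiece P (D 2 u))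

theorem tendsto_hermite {L : ℝ} (hL : 0 < L) {P : ℕ → Partition L}
    (hP : Tendsto (fun k => (P k).mesh) atTop (𝓝 0)) (u : H2 L) :
    Tendsto (fun k => hermite hL (P k) u) atTop (𝓝 u) := by
  have h := ((build hL).continuous.tendsto (value0 L u, slope0 L u, D 2 u)).comp
    (tendsto_const_nhds.prodMk_nhds (tendsto_const_nhds.prodMk_nhds (tendsto_projPiece hP (D 2 u))))
  rwa [build_eta] at h

theorem rep1_hermite_sub {L : ℝ} (hL : 0 < L) (P : Partition L) (u : H2 L) (x : ℝ) :
    rep1 (hermite hL P u) x = rep1 u x + prim (projPiece P (D 2 u) - D 2 u) x := by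
  rw [rep1, rep1, hermite, slope0_build, D_two_build, ← primL_apply, ← primL_apply, ← primL_apply,
    map_sub]
  abel

theorem rep1_hermite_node {L : ℝ} (hL : 0 < L) (P : Partition L) (u : H2 L) (i : Fin (P.J + 1)) :
    rep1 (hermite hL P u) (P.z i) = rep1 u (P.z i) := by
  rw [rep1_hermite_sub, prim_node_eq_zero P (inner_projPiece_sub P _), add_zero]

theorem rep0_hermite_node {L : ℝ} (hL : 0 < L) (P : Partition L) (u : H2 L) (i : Fin (P.J + 1)) :
    rep0 (hermite hL P u) (P.z i) = rep0 u (P.z i) := by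
  have h0 : value0 L (hermite hL P u) = value0 L u := value0_build hL _ _ _
  rw [rep0, rep0, h0]
  simp only [rep1_hermite_sub]
  rw [intervalIntegral.integral_add ((continuous_rep1 u).intervalIntegrable _ _)
    ((continuous_prim _).intervalIntegrable _ _),
    integral_prim_node_eq_zero P (inner_projPiece_sub P _), add_zero]

/-- On an interval where `u''` is affine, `u` is a cubic polynomial. -/
theorem exists_cubic {L : ℝ} (u : H2 L) {α β : ℝ} (a b : E3)
    (h : ∀ᵐ x ∂volume, x ∈ Ioo α β → ext (D 2 u) x = a + x • b) :
    ∃ c d : E3, ∀ x ∈ Icc α β,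
      rep0 u x = (x ^ 3 / 6) • b + (x ^ 2 / 2) • a + x • c + d := by
  have hsq : ∀ t : ℝ, HasDerivAt (fun t : ℝ => t ^ 2 / 2) t t := fun t => by
    simpa using (hasDerivAt_pow 2 t).div_const 2
  have hcb : ∀ t : ℝ, HasDerivAt (fun t : ℝ => t ^ 3 / 6) (t ^ 2 / 2) t := fun t => by
    refine ((hasDerivAt_pow 3 t).div_const 6).congr_deriv ?_
    push_cast
    ring
  have hG : ∀ t : ℝ, HasDerivAt (fun t : ℝ => t • a + (t ^ 2 / 2) • b) (a + t • b) t := fun t => by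
    simpa using ((hasDerivAt_id' t).smul_const a).fun_add ((hsq t).smul_const b)
  have h1 : ∀ x ∈ Icc α β, rep1 u x =
      (x • a + (x ^ 2 / 2) • b) + (rep1 u α - (α • a + (α ^ 2 / 2) • b)) := by
    intro x hx
    have e1 : rep1 u x - rep1 u α = ∫ t in α..x, ext (D 2 u) t := by
      rw [rep1, rep1, add_sub_add_left_eq_sub, prim_sub_prim]
    have e2 : ∫ t in α..x, ext (D 2 u) t = ∫ t in α..x, (a + t • b) := by
      rw [intervalIntegral.integral_of_le hx.1, intervalIntegral.integral_of_le hx.1,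
        integral_Ioc_eq_integral_Ioo, integral_Ioc_eq_integral_Ioo]
      refine setIntegral_congr_ae measurableSet_Ioo ?_
      filter_upwards [h] with t ht htx
      exact ht (Ioo_subset_Ioo_right hx.2 htx)
    have hc : Continuous fun t : ℝ => a + t • b := by fun_prop
    rw [e2, intervalIntegral.integral_eq_sub_of_hasDerivAt (fun t _ => hG t)
      (hc.intervalIntegrable _ _)] at e1
    rw [sub_eq_iff_eq_add.1 e1]
    abel
  set c := rep1 u α - (α • a + (α ^ 2 / 2) • b)
  have hH : ∀ t : ℝ, HasDerivAt (fun t : ℝ => (t ^ 3 / 6) • b + (t ^ 2 / 2) • a + t • c)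
      ((t • a + (t ^ 2 / 2) • b) + c) t := by
    intro t
    refine ((((hcb t).smul_const b).fun_add ((hsq t).smul_const a)).fun_add
      ((hasDerivAt_id' t).smul_const c)).congr_deriv ?_
    rw [one_smul, add_comm (t • a)]
  refine ⟨c, rep0 u α - ((α ^ 3 / 6) • b + (α ^ 2 / 2) • a + α • c), fun x hx => ?_⟩
  have e1 : rep0 u x - rep0 u α = ∫ t in α..x, rep1 u t := by
    rw [rep0, rep0, add_sub_add_left_eq_sub]
    exact intervalIntegral.integral_interval_sub_left
      ((continuous_rep1 u).intervalIntegrable _ _) ((continuous_rep1 u).intervalIntegrable _ _)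
  have e2 : ∫ t in α..x, rep1 u t = ∫ t in α..x, ((t • a + (t ^ 2 / 2) • b) + c) := by
    refine intervalIntegral.integral_congr fun t ht => ?_
    rw [uIcc_of_le hx.1] at ht
    exact h1 t ⟨ht.1, ht.2.trans hx.2⟩
  have hc : Continuous fun t : ℝ => (t • a + (t ^ 2 / 2) • b) + c := by fun_prop
  rw [e2, intervalIntegral.integral_eq_sub_of_hasDerivAt (fun t _ => hH t)
    (hc.intervalIntegrable _ _)] at e1
  rw [sub_eq_iff_eq_add.1 e1]
  abel

open Polynomial in
theorem rep0_hermite_mem_cubicSpace {L : ℝ} (hL : 0 < L) (P : Partition L) (u : H2 L) :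
    rep0 (hermite hL P u) ∈ cubicSpace P := by
  refine ⟨(contDiff_rep0 _).contDiffOn, fun j => ?_⟩
  obtain ⟨p, hp⟩ := exists_pieceL_eq_projPiece P (D 2 u)
  obtain ⟨c, d, hcd⟩ := exists_cubic (hermite hL P u) (α := P.z j.castSucc) (β := P.z j.succ)
    (p j).1 (p j).2 (by
      rw [hermite, D_two_build, ← hp]
      filter_upwards [ext_congr (pieceL_ae P p)] with x hx hxj
      rw [hx, indicator_of_mem, pieceFun_of_mem P p (Ioo_subset_Ico_self hxj)]
      exact ⟨(P.mem_Icc _).1.trans_lt hxj.1, hxj.2.trans_le (P.mem_Icc _).2⟩)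
  refine ⟨fun i => C ((p j).2 i / 6) * X ^ 3 + C ((p j).1 i / 2) * X ^ 2 + C (c i) * X + C (d i),
    fun i => natDegree_cubic_le, fun x hx i => ?_⟩
  rw [hcd x hx]
  simp
  ring

/-- Interpolation preserves u and u' at all nodes. The end points are nodes, so the value of `B`,
which sees only boundary data, is preserved as well. -/
theorem hermite_mem_discreteAdmissible {L : ℝ} (hL : 0 < L) (P : Partition L) {Φ : E3 → ℝ}
    (hΦ : Continuous Φ) {l : ℕ}
    {B : H2 L →L[ℝ] EuclideanSpace ℝ (Fin l)} {b : EuclideanSpace ℝ (Fin l)}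
    (hbdry : DependsOnBoundaryValues B) {u : H2 L} (hu : u ∈ admissible Φ B b) :
    hermite hL P u ∈ discreteAdmissible P Φ B b := by
  obtain ⟨h1, h2, h3⟩ := (mem_admissible_iff hL hΦ).1 hu
  refine (mem_discreteAdmissible_iff hL).2
    ⟨⟨_, rep0_hermite_mem_cubicSpace hL P u, isC1Rep_rep0 hL _⟩, fun j => ?_, ?_⟩
  · rw [rep1_hermite_node, rep0_hermite_node]
    exact ⟨h1 _ (P.mem_Icc j), h2 _ (P.mem_Icc j)⟩
  · rw [← h3]
    have hl : (0 : ℝ) ∈ Icc 0 L := ⟨le_rfl, hL.le⟩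
    have hr : L ∈ Icc 0 L := ⟨hL.le, le_rfl⟩
    refine hbdry _ _ _ _ (isC1Rep_rep0 hL _) (isC1Rep_rep0 hL _) ?_ ?_ ?_ ?_
    · simpa only [P.z_zero] using rep0_hermite_node hL P u 0
    · simpa only [P.z_last] using rep0_hermite_node hL P u (Fin.last _)
    · rw [derivWithin_rep0 hL _ hl, derivWithin_rep0 hL _ hl]
      simpa only [P.z_zero] using rep1_hermite_node hL P u 0
    · rw [derivWithin_rep0 hL _ hr, derivWithin_rep0 hL _ hr]
      simpa only [P.z_last] using rep1_hermite_node hL P u (Fin.last _)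

/-! ### Liminf inequality, equicoercivity and recovery sequences -/

section Energies
variable {L : ℝ} {γ : ℝ} {Φ : E3 → ℝ} {l : ℕ} {B : H2 L →L[ℝ] EuclideanSpace ℝ (Fin l)}
  {b : EuclideanSpace ℝ (Fin l)}

theorem energy_of_mem {u : H2 L} (h : u ∈ admissible Φ B b) :
    energy γ Φ B b u = (bending γ Φ u : EReal) := if_pos h

theorem mem_admissible_of_energy_ne_top {u : H2 L} (h : energy γ Φ B b u ≠ ⊤) :
    u ∈ admissible Φ B b := by_contra fun h' => h (if_neg h')

theorem discreteEnergy_of_mem {P : Partition L} {u : H2 L} (h : u ∈ discreteAdmissible P Φ B b) :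
    discreteEnergy P γ Φ B b u = (bending γ Φ u : EReal) := if_pos h

theorem mem_discreteAdmissible_of_discreteEnergy_ne_top {P : Partition L} {u : H2 L}
    (h : discreteEnergy P γ Φ B b u ≠ ⊤) : u ∈ discreteAdmissible P Φ B b :=
  by_contra fun h' => h (if_neg h')

/-- Bounded bending energy bounds the second derivative. -/
theorem norm_D_two_le_of_bending_le (hγ0 : 0 ≤ γ) (hγ1 : γ < 1) (hΦ : ContDiff ℝ 1 Φ) {u : H2 L}
    {c : ℝ} (h : bending γ Φ u ≤ c) : ‖D 2 u‖ ≤ √(2 * c / (1 - γ)) := by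
  refine Real.le_sqrt_of_sq_le ?_
  have h1 := (le_bending hγ0 hΦ u).trans h
  rw [le_div_iff₀ (by linarith)]
  linarith

/-- The liminf inequality along weakly convergent sequences of curves. -/
theorem energy_le_liminf (hL : 0 < L) (hγ0 : 0 ≤ γ) (hγ1 : γ < 1) (hΦ : ContDiff ℝ 1 Φ)
    (hreg : ∀ s, Φ s = 0 → gradient Φ s ≠ 0) {P : ℕ → Partition L}
    (hP : Tendsto (fun k => (P k).mesh) atTop (𝓝 0)) {u : ℕ → H2 L} {u₀ : H2 L}
    (hu : WeakTendsto u u₀) :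
    energy γ Φ B b u₀ ≤ liminf (fun k => discreteEnergy (P k) γ Φ B b (u k)) atTop := by
  -- The lower limit is a cluster point, so some subsequence of energies converges to it.
  obtain ⟨φ, hφ, hlim⟩ := (MapClusterPt.liminf
    (u := fun k => discreteEnergy (P k) γ Φ B b (u k)) (f := atTop)).tendsto_subseq
  set ℓ := liminf (fun k => discreteEnergy (P k) γ Φ B b (u k)) atTop
  rcases eq_or_ne ℓ ⊤ with h | h
  · rw [h]; exact le_top
  obtain ⟨M, hM, -⟩ := EReal.lt_iff_exists_real_btwn.1 (lt_top_iff_ne_top.2 h)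
  obtain ⟨N, hN⟩ := eventually_atTop.1 (hlim.eventually_lt_const hM)
  -- Dropping the first N terms makes all energies finite and bounded by M, so that every remaining
  -- curve is discretely admissible.
  set ψ : ℕ → ℕ := fun k => φ (k + N)
  have hψt : Tendsto ψ atTop atTop := hφ.tendsto_atTop.comp (tendsto_add_atTop_nat N)
  have hlim' : Tendsto (fun k => discreteEnergy (P (ψ k)) γ Φ B b (u (ψ k))) atTop (𝓝 ℓ) :=
    hlim.comp (tendsto_add_atTop_nat N)
  have hlt : ∀ k, discreteEnergy (P (ψ k)) γ Φ B b (u (ψ k)) < M := fun k =>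
    hN (k + N) (Nat.le_add_left _ _)
  have hmem : ∀ k, u (ψ k) ∈ discreteAdmissible (P (ψ k)) Φ B b := fun k =>
    mem_discreteAdmissible_of_discreteEnergy_ne_top ((hlt k).trans (EReal.coe_lt_top M)).ne
  have hbd : ∀ k, ‖D 2 (u (ψ k))‖ ≤ √(2 * M / (1 - γ)) := fun k => by
    refine norm_D_two_le_of_bending_le hγ0 hγ1 hΦ ?_
    have := hlt k
    rw [discreteEnergy_of_mem (hmem k), EReal.coe_lt_coe_iff] at this
    exact this.le
  have hw := hu.comp hψt
  have hadm : u₀ ∈ admissible Φ B b :=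
    hw.mem_admissible hL hΦ.continuous (hP.comp hψt) hmem hbd
  obtain ⟨r, hr, hrt⟩ := hw.exists_le_bending hL hγ0 hγ1 hΦ hreg hadm.2.1 hbd
  rw [energy_of_mem hadm]
  refine le_of_tendsto_of_tendsto' ((continuous_coe_real_ereal.tendsto _).comp hrt) hlim'
    fun k => ?_
  rw [discreteEnergy_of_mem (hmem k)]
  exact EReal.coe_le_coe_iff.2 (hr k)

/-- Equicoercivity. -/
theorem exists_weakTendsto_subseq_of_bending_le (hL : 0 < L) (hγ0 : 0 ≤ γ) (hγ1 : γ < 1)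
    (hΦ : ContDiff ℝ 1 Φ) (hdef : Definiteness B) {P : ℕ → Partition L} {u : ℕ → H2 L}
    (hu : ∀ k, u k ∈ discreteAdmissible (P k) Φ B b) {c : ℝ} (hc : ∀ k, bending γ Φ (u k) ≤ c) :
    ∃ u₀ : H2 L, ∃ φ : ℕ → ℕ, StrictMono φ ∧ WeakTendsto (fun k => u (φ k)) u₀ := by
  obtain ⟨K, hK0, hK⟩ := exists_norm_value0_le hL hdef
  have hM := fun k => norm_D_two_le_of_bending_le hγ0 hγ1 hΦ (hc k)
  have hd := fun k => ((mem_discreteAdmissible_iff hL).1 (hu k)).2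
  -- The node z_0 = 0 carries the constraint |u'(0)| = 1.
  have hC : ∀ k, ‖slope0 L (u k)‖ ≤ 1 := fun k => by
    have h := ((hd k).1 0).1
    rw [(P k).z_zero, rep1, prim_zero, add_zero] at h
    exact abs_norm (slope0 L (u k)) ▸ (sq_le_one_iff_abs_le_one _).1 h.le
  refine exists_weakTendsto_subseq hL u (A := K * (‖b‖ + 1 + √(2 * c / (1 - γ)))) (fun k => ?_)
    hC hM
  refine (hK (u k)).trans ?_
  rw [(hd k).2]
  gcongr
  exacts [hC k, hM k]

/-- Strong recovery sequences. The Hermite interpolants converge strongly in `H²` for every curve in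
`H²`, so that no approximation by curves in `H³` is involved. -/
theorem exists_recovery (hL : 0 < L) (hΦ : ContDiff ℝ 1 Φ)
    (hreg : ∀ s, Φ s = 0 → gradient Φ s ≠ 0) (hbdry : DependsOnBoundaryValues B)
    {P : ℕ → Partition L} (hP : Tendsto (fun k => (P k).mesh) atTop (𝓝 0)) {u₀ : H2 L}
    (hu : u₀ ∈ admissible Φ B b) :
    ∃ u : ℕ → H2 L, Tendsto u atTop (𝓝 u₀) ∧
      Tendsto (fun k => discreteEnergy (P k) γ Φ B b (u k)) atTop (𝓝 (energy γ Φ B b u₀)) := by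
  refine ⟨fun k => hermite hL (P k) u₀, tendsto_hermite hL hP u₀, ?_⟩
  simp only [fun k => discreteEnergy_of_mem (γ := γ)
    (hermite_mem_discreteAdmissible hL (P k) hΦ.continuous hbdry hu), energy_of_mem hu]
  exact (continuous_coe_real_ereal.tendsto _).comp
    (tendsto_bending hL hΦ hreg (tendsto_hermite hL hP u₀) hu.2.1)

end Energies

end CurveFEM

end

/-! ### The Γ-convergence theorem -/

theorem mainTheorem1 (L : ℝ) (hL : 0 < L) (γ : ℝ) (hγ0 : 0 ≤ γ) (hγ1 : γ < 1)
    (Φ : E3 → ℝ) (hΦ : ContDiff ℝ 1 Φ) (hreg : ∀ s, Φ s = 0 → gradient Φ s ≠ 0)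
    (l : ℕ) (B : H2 L →L[ℝ] EuclideanSpace ℝ (Fin l)) (b : EuclideanSpace ℝ (Fin l))
    (hbdry : DependsOnBoundaryValues B) (hdef : Definiteness B)
    (hne : (admissible Φ B b).Nonempty)
    (hdense : admissible Φ B b ⊆ closure (admissible Φ B b ∩ H3 L))
    (P : ℕ → Partition L) (hP : Tendsto (fun k => (P k).mesh) atTop (𝓝 0)) :
    -- (i) compactness, with the liminf inequality
    (∀ (u : ℕ → H2 L) (c : ℝ), (∀ k, u k ∈ discreteAdmissible (P k) Φ B b) →
      (∀ k, discreteEnergy (P k) γ Φ B b (u k) ≤ (c : EReal)) →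
      ∃ u₀ ∈ admissible Φ B b, ∃ φ : ℕ → ℕ, StrictMono φ ∧
        WeakTendsto (fun k => u (φ k)) u₀ ∧
        energy γ Φ B b u₀ ≤ liminf (fun k => discreteEnergy (P k) γ Φ B b (u k)) atTop) ∧
    -- (i) the liminf inequality along every weakly convergent sequence
    (∀ (u : ℕ → H2 L) (u₀ : H2 L), WeakTendsto u u₀ →
      energy γ Φ B b u₀ ≤ liminf (fun k => discreteEnergy (P k) γ Φ B b (u k)) atTop) ∧
    -- (ii) strong recovery sequences
    (∀ u₀ ∈ admissible Φ B b, ∃ u : ℕ → H2 L, Tendsto u atTop (𝓝 u₀) ∧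
      Tendsto (fun k => discreteEnergy (P k) γ Φ B b (u k)) atTop (𝓝 (energy γ Φ B b u₀))) ∧
    -- (iii) weak accumulation points of quasiminimizers are minimizers
    (∀ (u : ℕ → H2 L) (u₀ : H2 L) (φ : ℕ → ℕ),
      IsQuasiMinimizing (fun k => discreteEnergy (P k) γ Φ B b) u →
      StrictMono φ → WeakTendsto (fun k => u (φ k)) u₀ →
      u₀ ∈ admissible Φ B b ∧ ∀ v : H2 L, energy γ Φ B b u₀ ≤ energy γ Φ B b v) := by
  have hrec : ∀ u₀ ∈ admissible Φ B b, ∃ u : ℕ → H2 L, Tendsto u atTop (𝓝 u₀) ∧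
      Tendsto (fun k => discreteEnergy (P k) γ Φ B b (u k)) atTop (𝓝 (energy γ Φ B b u₀)) :=
    fun u₀ hu => exists_recovery hL hΦ hreg hbdry hP hu
  refine ⟨fun u c hu hc => ?_, fun u u₀ hu => energy_le_liminf hL hγ0 hγ1 hΦ hreg hP hu, hrec,
    fun u u₀ φ hq hφ hw => ?_⟩
  · obtain ⟨φ, hφ, hlim⟩ := (MapClusterPt.liminf
      (u := fun k => discreteEnergy (P k) γ Φ B b (u k)) (f := atTop)).tendsto_subseq
    have hc' : ∀ k, bending γ Φ (u k) ≤ c := fun k => by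
      have := hc k
      rwa [discreteEnergy_of_mem (hu k), EReal.coe_le_coe_iff] at this
    obtain ⟨u₀, ψ, hψ, hw⟩ := exists_weakTendsto_subseq_of_bending_le hL hγ0 hγ1 hΦ hdef
      (P := fun k => P (φ k)) (u := fun k => u (φ k)) (fun k => hu _) (fun k => hc' _)
    have hle := energy_le_liminf (B := B) (b := b) hL hγ0 hγ1 hΦ hreg
      (hP.comp (hφ.comp hψ).tendsto_atTop) hw
    have hlim' := hlim.comp hψ.tendsto_atTop
    have hle' : energy γ Φ B b u₀ ≤
        liminf (fun k => discreteEnergy (P k) γ Φ B b (u k)) atTop :=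
      hle.trans_eq hlim'.liminf_eq
    have hfin : energy γ Φ B b u₀ ≤ c :=
      hle.trans (liminf_le_of_le (f := atTop) (by isBoundedDefault) fun a ha => by
        obtain ⟨k, hk⟩ := ha.exists
        exact hk.trans (hc _))
    exact ⟨u₀, mem_admissible_of_energy_ne_top (hfin.trans_lt (EReal.coe_lt_top c)).ne,
      fun k => φ (ψ k), hφ.comp hψ, hw, hle'⟩
  · obtain ⟨ε, hε0, hε, hmin⟩ := hq
    have hle := energy_le_liminf (B := B) (b := b) hL hγ0 hγ1 hΦ hreg
      (hP.comp hφ.tendsto_atTop) hw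
    have key : ∀ v ∈ admissible Φ B b, energy γ Φ B b u₀ ≤ energy γ Φ B b v := by
      intro v hv
      obtain ⟨w, -, hwlim⟩ := hrec v hv
      have h1 : Tendsto (fun k => discreteEnergy (P k) γ Φ B b (w k) + (ε k : EReal)) atTop
          (𝓝 (energy γ Φ B b v)) := by
        -- Addition of extended reals is continuous here because the limit 0 of the errors is
        -- finite.
        have := (EReal.continuousAt_add (p := (energy γ Φ B b v, ((0 : ℝ) : EReal)))
          (Or.inr (EReal.coe_ne_bot 0)) (Or.inr (EReal.coe_ne_top 0))).tendsto.comp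
          (hwlim.prodMk_nhds ((continuous_coe_real_ereal.tendsto 0).comp hε))
        simpa [Function.comp_def] using this
      refine hle.trans ?_
      rw [← (h1.comp hφ.tendsto_atTop).liminf_eq]
      exact liminf_le_liminf (Eventually.of_forall fun k => hmin (φ k) (w (φ k)))
    obtain ⟨v₀, hv₀⟩ := hne
    refine ⟨mem_admissible_of_energy_ne_top (γ := γ) ?_, fun v => ?_⟩
    -- Comparison with one admissible curve shows that the limit has finite energy, hence is
    -- admissible.
    · refine ((key v₀ hv₀).trans_lt ?_).ne
      rw [energy_of_mem hv₀]
      exact EReal.coe_lt_top _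
    · by_cases hv : v ∈ admissible Φ B b
      · exact key v hv
      · exact le_top.trans_eq (if_neg hv).symm
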